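/- Conventions. All arrangements are finite sets of hyperplanes in finite-dimensional real vector spaces, $[s,t]=\{k\in\mathbb Z: s\le k\le t\}$, and "$x_i=[s,t]$" stands for the hyperplanes $x_i=k$, $k\in[s,t]$ (similarly for $x_i-x_j$). The cone $\mathbf c\mathcal A$ of an affine arrangement $\mathcal A$ in $V$ is the central arrangement in $V\times\mathbb R$ consisting of $z=0$ and of the hyperplanes $\alpha=cz$ for the hyperplanes $\alpha=c$ of $\mathcal A$. A central arrangement $\mathcal A$ in $V$, $\dim V=r$, is free with exponents $\exp(\mathcal A)=(e_1,\dots,e_r)$ (a multiset) if the module $D(\mathcal A)$ of derivations $\theta$ of $S=S(V^*)$ with $\theta(\alpha_H)\in\alpha_H S$ for all $H=\ker\alpha_H\in\mathcal A$ has an $S$-basis of homogeneous derivations of degrees $e_1,\dots,e_r$. For a subspace $X$, $\mathcal A^X=\{H\cap X: H\in\mathcal A,\ X\not\subseteq H\}$. Inductively free arrangements form the smallest class containing the empty arrangements and containing $\mathcal A$ whenever for some $H\in\mathcal A$ it contains $\mathcal A'=\mathcal A\setminus\{H\}$ and $\mathcal A^H$, and $\exp(\mathcal A^H)\subseteq\exp(\mathcal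 A')$. A central arrangement $\mathcal A$ in $V$, free with exponents $e_1\le\dots\le e_r$, is ind-flag-accurate with witness $X_1\subseteq X_2\subseteq\dots\subseteq X_r=V$ if $\mathcal A$ is inductively free and, for each $1\le d\le r$, $X_d$ is an intersection of hyperplanes of $\mathcal A$ with $\dim X_d=d$ and $\mathcal A^{X_d}$ is inductively free with exponents $(e_1,\dots,e_d)$. Theorem. (1) Let $a,m\ge0$, $n,\ell\ge1$ and $0\le p\le\ell$ be integers, and let $\mathcal E^p_\ell(n,a,m)$ be the arrangement in $\mathbb R^\ell$ consisting of the hyperplanes $$x_i-x_j=[-a,a]\ (1\le i<j\le\ell),\qquad x_i=[-na,m]\ (1\le i\le p),\qquad x_i=[-na,m+1]\ (p<i\le\ell).$$ The cone $\mathbf c\mathcal E^p_\ell(n,a,m)$ is ind-flag-accurate with exponents $$(1,\ \ell-p+1,\ 2,3,\dots,\ell)+(0,(m+a(\ell+n-1))^\ell).$$ (2) As a consequence, let $c\ge1$, $m\ge0$, $\ell\ge1$, $0\le p\le\ell$, and let $\mathcal R^{p,1}_\ell(c,m)$ be the arrangement in $\mathbb R^\ell$ with hyperplanes $x_i-x_j=0$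 and $x_i-x_j=1$ for all $i\ne j$, $x_i=[-c,m]$ for $i\le p$ and $x_i=[-c,m+1]$ for $i>p$ (the digraphic arrangement of the complete digraph with these weights). Then $\mathcal R^{p,1}_\ell(c,m)=\mathcal E^p_\ell(c,1,m)$, and its cone is ind-flag-accurate with exponents $(1,\ell-p+1,2,3,\dots,\ell)+(0,(m+\ell+c-1)^\ell)$. (3) As a corollary, let $\ell,m\ge1$ and let $\mathrm{Cat}^m(A_\ell)$ be the extended Catalan arrangement of type $A_\ell$: the arrangement in $\{y\in\mathbb R^{\ell+1}:\sum_i y_i=0\}$ with hyperplanes $y_i-y_j=[-m,m]$, $1\le i<j\le\ell+1$. It is affinely equivalent to $\mathcal E^\ell_\ell(1,m,m)$ and to $\mathcal E^0_\ell(1,m,m-1)$, and its cone is ind-flag-accurate with exponents $(1,\,m(\ell+1)+1,\dots,m(\ell+1)+\ell)$. Moreover, there is a simple root witness: with $H_i$ the hyperplane $y_i-y_{i+1}=mz$ ($1\le i\le\ell$) of $\mathbf c\,\mathrm{Cat}^m(A_\ell)$, the flag $\bigcap_{j\le\ell}H_j\subseteq\dots\subseteq H_1\cap H_2\subseteq H_1\subseteq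 V'$, where $V'$ is the ambient space of the cone, is a witness for the ind-flag-accuracy of $\mathbf c\,\mathrm{Cat}^m(A_\ell)$. Likewise, in $\mathbf c\,\mathcal E^0_\ell(1,m,m-1)$, the flag formed in the same way from $H_1:\ x_1=-mz$ and $H_i:\ x_{i-1}-x_i=mz$ ($2\le i\le\ell$) is a witness for its ind-flag-accuracy. -/

import Mathlib

open scoped BigOperators

universe u

namespace HypArr

noncomputable section

/-! ### Central arrangements over the reals -/

/-- A central (hyperplane) arrangement in a real vector space `V`: a finite set of linear
hyperplanes, that is, of kernels of nonzero linear forms. -/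
@[ext]
structure CentralArr (V : Type u) [AddCommGroup V] [Module ℝ V] where
  planes : Set (Submodule ℝ V)
  finite : planes.Finite
  hyperplane : ∀ H ∈ planes, ∃ α : Module.Dual ℝ V, α ≠ 0 ∧ H = LinearMap.ker α

namespace CentralArr

variable {V : Type u} [AddCommGroup V] [Module ℝ V]

/-- `X` belongs to the intersection lattice `L(A)`; the empty intersection is `V`. -/
def IsFlat (A : CentralArr V) (X : Submodule ℝ V) : Prop :=
  ∃ B : Set (Submodule ℝ V), B ⊆ A.planes ∧ X = sInf B

/-- The deletion `A' = A \ {H}`. -/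
def deletion (A : CentralArr V) (H : Submodule ℝ V) : CentralArr V where
  planes := A.planes \ {H}
  finite := A.finite.subset Set.sdiff_subset
  hyperplane K hK := A.hyperplane K hK.1

/-- The restriction `A^X = {H ∩ X | H ∈ A, X ⊄ H}`, an arrangement in the vector space `X`. -/
def restriction (A : CentralArr V) (X : Submodule ℝ V) : CentralArr X where
  planes := {K | ∃ H ∈ A.planes, ¬ X ≤ H ∧ K = H.comap X.subtype}
  finite := (A.finite.image fun H => H.comap X.subtype).subset (by
    rintro K ⟨H, hH, -, rfl⟩
    exact ⟨H, hH, rfl⟩)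
  hyperplane := by
    rintro K ⟨H, hH, hX, rfl⟩
    obtain ⟨α, -, rfl⟩ := A.hyperplane H hH
    refine ⟨α.comp X.subtype, fun h0 => hX fun x hx => ?_, rfl⟩
    exact LinearMap.congr_fun h0 ⟨x, hx⟩

/-- The linear form `α` as an element of `S(V*) = ℝ[x_1, …, x_n]`, where `x_1, …, x_n` is the
basis of `V*` dual to the basis `b` of `V`. -/
def linForm {ι : Type*} [Fintype ι] (b : Module.Basis ι ℝ V) (α : Module.Dual ℝ V) :
    MvPolynomial ι ℝ :=
  ∑ i, MvPolynomial.C (α (b i)) * MvPolynomial.X i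

/-- The module `D(A)` of `A`-derivations: the derivations `θ` of `S = ℝ[x_1, …, x_n]` such that
`θ(α_H) ∈ α_H S` for every `H = ker α_H` in `A`. -/
def der (A : CentralArr V) {ι : Type*} [Fintype ι] (b : Module.Basis ι ℝ V) :
    Submodule (MvPolynomial ι ℝ) (Derivation ℝ (MvPolynomial ι ℝ) (MvPolynomial ι ℝ)) where
  carrier := {θ | ∀ α : Module.Dual ℝ V, LinearMap.ker α ∈ A.planes →
    linForm b α ∣ θ (linForm b α)}
  add_mem' hθ hη α hα := dvd_add (hθ α hα) (hη α hα)
  zero_mem' _ _ := dvd_zero _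
  smul_mem' f _ hθ α hα := (hθ α hα).mul_left f

/-- `A` is free with multiset of exponents `e`: the `S`-module `D(A)` has a finite basis of
homogeneous derivations whose degrees form the multiset `e`. (This does not depend on the chosen
coordinates.) -/
def HasExponents (A : CentralArr V) (e : Multiset ℕ) : Prop :=
  ∃ (n : ℕ) (b : Module.Basis (Fin n) ℝ V)
    (θ : Module.Basis (Fin n) (MvPolynomial (Fin n) ℝ) (A.der b)) (d : Fin n → ℕ),
    (∀ i j : Fin n,
      ((θ i : Derivation ℝ (MvPolynomial (Fin n) ℝ) (MvPolynomial (Fin n) ℝ))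
        (MvPolynomial.X j)).IsHomogeneous (d i)) ∧
    e = Finset.univ.val.map d

end CentralArr

/-- The class of inductively free arrangements: the smallest class that contains the empty
arrangements and contains `A` whenever, for some `H ∈ A`, it contains `A' = A \ {H}` and
`A'' = A^H`, and `exp(A'') ⊆ exp(A')`. -/
inductive IsInductivelyFree :
    ∀ {V : Type u} [AddCommGroup V] [Module ℝ V], CentralArr V → Prop
  | empty {V : Type u} [AddCommGroup V] [Module ℝ V] [FiniteDimensional ℝ V]
      (A : CentralArr V) (hA : A.planes = ∅) : IsInductivelyFree A
  | addition {V : Type u} [AddCommGroup V] [Module ℝ V] (A : CentralArr V)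
      (H : Submodule ℝ V) (hH : H ∈ A.planes) (e' e'' : Multiset ℕ)
      (hdel : IsInductivelyFree (A.deletion H))
      (hres : IsInductivelyFree (A.restriction H))
      (hexp' : (A.deletion H).HasExponents e')
      (hexp'' : (A.restriction H).HasExponents e'')
      (hle : e'' ≤ e') : IsInductivelyFree A

namespace CentralArr

variable {V : Type u} [AddCommGroup V] [Module ℝ V]

/-- `(X 1, …, X ℓ)`, `ℓ = dim V`, is a witness for the accuracy of `A`: `A` is free with exponents
`e_1 ≤ … ≤ e_ℓ`, and for `1 ≤ d ≤ ℓ`, `X d` is a flat of `A` of dimension `d` such that `A^(X d)`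
is free with exponents `(e_1, …, e_d)`. Values `X d` for other `d` play no role. -/
def IsAccuracyWitness (A : CentralArr V) (X : ℕ → Submodule ℝ V) : Prop :=
  ∃ e : List ℕ, e.Pairwise (· ≤ ·) ∧ A.HasExponents (e : Multiset ℕ) ∧
    ∀ d, 1 ≤ d → d ≤ Module.finrank ℝ V →
      A.IsFlat (X d) ∧ Module.finrank ℝ (X d) = d ∧
        (A.restriction (X d)).HasExponents (e.take d : Multiset ℕ)

/-- A witness for the accuracy that is a flag `X 1 ⊆ X 2 ⊆ … ⊆ X ℓ`. -/
def IsFlagAccuracyWitness (A : CentralArr V) (X : ℕ → Submodule ℝ V) : Prop :=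
  A.IsAccuracyWitness X ∧ ∀ d, 1 ≤ d → d < Module.finrank ℝ V → X d ≤ X (d + 1)

/-- A witness for the ind-flag-accuracy of `A`. -/
def IsIndFlagAccuracyWitness (A : CentralArr V) (X : ℕ → Submodule ℝ V) : Prop :=
  IsInductivelyFree A ∧ A.IsFlagAccuracyWitness X ∧
    ∀ d, 1 ≤ d → d ≤ Module.finrank ℝ V → IsInductivelyFree (A.restriction (X d))

/-- `A` is ind-flag-accurate. -/
def IsIndFlagAccurate (A : CentralArr V) : Prop :=
  ∃ X : ℕ → Submodule ℝ V, A.IsIndFlagAccuracyWitness X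

end CentralArr

/-! ### Affine arrangements and their cones -/

/-- An affine arrangement in `V`: a finite set of affine hyperplanes `{v | α v = c}`, `α ≠ 0`. -/
@[ext]
structure AffineArr (V : Type u) [AddCommGroup V] [Module ℝ V] where
  planes : Set (Set V)
  finite : planes.Finite
  hyperplane : ∀ H ∈ planes, ∃ (α : Module.Dual ℝ V) (c : ℝ), α ≠ 0 ∧ H = {v | α v = c}

section Cone

variable {V : Type u} [AddCommGroup V] [Module ℝ V]

/-- The hyperplane at infinity `z = 0` in `V × ℝ`. -/
def planeAtInfinity (V : Type u) [AddCommGroup V] [Module ℝ V] : Submodule ℝ (V × ℝ) :=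
  LinearMap.ker (LinearMap.snd ℝ V ℝ)

/-- The homogenization `α = c z` in `V × ℝ` of the affine hyperplane `α = c` in `V`. -/
def homogenize (α : Module.Dual ℝ V) (c : ℝ) : Submodule ℝ (V × ℝ) :=
  LinearMap.ker (α.comp (LinearMap.fst ℝ V ℝ) - c • LinearMap.snd ℝ V ℝ)

theorem mem_homogenize (α : Module.Dual ℝ V) (c : ℝ) (w : V × ℝ) :
    w ∈ homogenize α c ↔ α w.1 = c * w.2 := by
  simp [homogenize, sub_eq_zero]

theorem homogenize_le {α β : Module.Dual ℝ V} {c d : ℝ} (hα : α ≠ 0)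
    (h : {v | α v = c} = {v | β v = d}) : homogenize α c ≤ homogenize β d := by
  have key : ∀ v, α v = c → β v = d := fun v hv => (Set.ext_iff.1 h v).1 hv
  intro w hw
  rw [mem_homogenize] at hw ⊢
  obtain ⟨v, z⟩ := w
  simp only at hw ⊢
  by_cases hz : z = 0
  · obtain ⟨v₀, hv₀⟩ := LinearMap.surjective hα c
    have h1 := key v₀ hv₀
    have h2 := key (v₀ + v) (by rw [map_add, hv₀, hw, hz]; ring)
    rw [map_add, h1] at h2
    rw [hz]
    linarith
  · have h1 := key (z⁻¹ • v) (by rw [map_smul, hw, smul_eq_mul]; field_simp)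
    rw [map_smul, smul_eq_mul] at h1
    rw [← h1]
    field_simp

/-- The cone over an affine arrangement in `V`: the central arrangement in `V × ℝ` consisting of
the hyperplane at infinity and the homogenizations of all hyperplanes. -/
def AffineArr.cone (A : AffineArr V) : CentralArr (V × ℝ) where
  planes := insert (planeAtInfinity V)
    {K | ∃ (α : Module.Dual ℝ V) (c : ℝ), α ≠ 0 ∧ {v | α v = c} ∈ A.planes ∧
      K = homogenize α c}
  finite := by
    classical
    refine Set.Finite.insert _ ?_
    choose! α c h using A.hyperplane
    refine (A.finite.image fun H => homogenize (α H) (c H)).subset ?_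
    rintro K ⟨β, d, hβ, hmem, rfl⟩
    obtain ⟨h1, h2⟩ := h _ hmem
    exact ⟨_, hmem, le_antisymm (homogenize_le h1 h2.symm) (homogenize_le hβ h2)⟩
  hyperplane := by
    rintro K (rfl | ⟨α, c, hα, -, rfl⟩)
    · refine ⟨LinearMap.snd ℝ V ℝ, fun h => ?_, rfl⟩
      simpa using LinearMap.congr_fun h ((0 : V), (1 : ℝ))
    · refine ⟨_, fun h => hα (LinearMap.ext fun v => ?_), rfl⟩
      simpa using LinearMap.congr_fun h (v, (0 : ℝ))

/-- Affine equivalence of affine arrangements. -/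
def AffineArr.AffinelyEquivalent {W : Type u} [AddCommGroup W] [Module ℝ W]
    (A : AffineArr V) (B : AffineArr W) : Prop :=
  ∃ φ : V ≃ᵃ[ℝ] W, B.planes = (fun H : Set V => φ '' H) '' A.planes

end Cone

/-! ### The arrangements in `ℝ^ℓ`

Coordinates are indexed by `Fin ℓ`, so that `x_i` of the usual notation is `coord ℓ (i - 1)`. -/

/-- The coordinate function `x_i` on `ℝ^ℓ`. -/
def coord (ℓ : ℕ) (i : Fin ℓ) : Module.Dual ℝ (Fin ℓ → ℝ) := LinearMap.proj i

theorem coord_ne_zero (ℓ : ℕ) (i : Fin ℓ) : coord ℓ i ≠ 0 := fun h => by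
  simpa [coord] using LinearMap.congr_fun h (Pi.single i 1)

theorem coord_sub_coord_ne_zero (ℓ : ℕ) {i j : Fin ℓ} (hij : i ≠ j) :
    coord ℓ i - coord ℓ j ≠ 0 := fun h => by
  simpa [coord, hij.symm] using LinearMap.congr_fun h (Pi.single i 1)

/-- The affine arrangement in `ℝ^ℓ` with the hyperplanes `x_i - x_j = k` for `i ≠ j` and
`k ∈ D i j`, and the hyperplanes `x_i = k` for `k ∈ N i`. -/
def diffArr (ℓ : ℕ) (D : Fin ℓ → Fin ℓ → Finset ℤ) (N : Fin ℓ → Finset ℤ) :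
    AffineArr (Fin ℓ → ℝ) where
  planes :=
    {H | ∃ i j : Fin ℓ, i ≠ j ∧ ∃ k ∈ D i j, H = {x | (coord ℓ i - coord ℓ j) x = (k : ℝ)}} ∪
    {H | ∃ i : Fin ℓ, ∃ k ∈ N i, H = {x | coord ℓ i x = (k : ℝ)}}
  finite := by
    refine Set.Finite.union ?_ ?_
    · refine (Set.finite_iUnion fun i => Set.finite_iUnion fun j =>
        (D i j).finite_toSet.image fun k : ℤ =>
          {x : Fin ℓ → ℝ | (coord ℓ i - coord ℓ j) x = (k : ℝ)}).subset ?_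
      rintro H ⟨i, j, -, k, hk, rfl⟩
      exact Set.mem_iUnion.2 ⟨i, Set.mem_iUnion.2 ⟨j, k, hk, rfl⟩⟩
    · refine (Set.finite_iUnion fun i => (N i).finite_toSet.image fun k : ℤ =>
          {x : Fin ℓ → ℝ | coord ℓ i x = (k : ℝ)}).subset ?_
      rintro H ⟨i, k, hk, rfl⟩
      exact Set.mem_iUnion.2 ⟨i, k, hk, rfl⟩
  hyperplane := by
    rintro H (⟨i, j, hij, k, -, rfl⟩ | ⟨i, k, -, rfl⟩)
    · exact ⟨_, _, coord_sub_coord_ne_zero ℓ hij, rfl⟩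
    · exact ⟨_, _, coord_ne_zero ℓ i, rfl⟩

/-- The arrangement `E^p_ℓ(n, a, m)` in `ℝ^ℓ`, with the hyperplanes `x_i - x_j = k` for `i < j`
and `k ∈ [-a, a]`, the hyperplanes `x_i = k` for `i ≤ p` and `k ∈ [-na, m]`, and the hyperplanes
`x_i = k` for `i > p` and `k ∈ [-na, m + 1]` (here `i` runs through `1, …, ℓ`). -/
def arrE (p ℓ n a m : ℕ) : AffineArr (Fin ℓ → ℝ) :=
  diffArr ℓ (fun i j => if i < j then Finset.Icc (-(a : ℤ)) (a : ℤ) else ∅)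
    (fun i => if (i : ℕ) < p then Finset.Icc (-((n : ℤ) * (a : ℤ))) (m : ℤ)
      else Finset.Icc (-((n : ℤ) * (a : ℤ))) ((m : ℤ) + 1))

open Classical in
/-- The `ψ`-digraphic arrangement of a digraph `G` on `ℓ` vertices with weight `ψ`, with the
hyperplanes `x_i - x_j = 0` for all `i ≠ j`, `x_i - x_j = 1` for every edge `(i, j)` of `G`, and
`x_i = k` for `k ∈ ψ i`. -/
def digraphicArr (ℓ : ℕ) (G : Digraph (Fin ℓ)) (ψ : Fin ℓ → Finset ℤ) :
    AffineArr (Fin ℓ → ℝ) :=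
  diffArr ℓ (fun i j => if G.Adj i j then {0, 1} else {0}) ψ

/-- The origin `R^{p,1}_ℓ(c, m)` of the Catalan descendant sequence: the digraphic arrangement of
the complete digraph on `[ℓ]` with weight `[-c, m]` at the vertices `i ≤ p` and `[-c, m + 1]` at
the vertices `i > p`. -/
def catalanOrigin (p ℓ c m : ℕ) : AffineArr (Fin ℓ → ℝ) :=
  digraphicArr ℓ ⟨fun i j => i ≠ j⟩
    (fun i => if (i : ℕ) < p then Finset.Icc (-(c : ℤ)) (m : ℤ)
      else Finset.Icc (-(c : ℤ)) ((m : ℤ) + 1))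

/-- The multiset `(1, ℓ - p + 1, 2, 3, …, ℓ) + (0, s^ℓ)` (for `p ≤ ℓ`). -/
def shiftedExps (p ℓ s : ℕ) : Multiset ℕ :=
  1 ::ₘ (((ℓ - p + 1) ::ₘ (Finset.Icc 2 ℓ).val).map fun e => e + s)

/-! ### The root system of type `A_ℓ` and extended Catalan arrangements -/

/-- The `ℓ`-dimensional space `{y ∈ ℝ^(ℓ+1) | y_1 + … + y_(ℓ+1) = 0}`. -/
def spaceA (ℓ : ℕ) : Submodule ℝ (Fin (ℓ + 1) → ℝ) :=
  LinearMap.ker (∑ i, coord (ℓ + 1) i)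

/-- The root `y_i - y_j`, a linear form on `spaceA ℓ`. It is a positive root iff `i < j`. -/
def rootA (ℓ : ℕ) (i j : Fin (ℓ + 1)) : Module.Dual ℝ (spaceA ℓ) :=
  (coord (ℓ + 1) i - coord (ℓ + 1) j).comp (spaceA ℓ).subtype

/-- The simple roots `y_i - y_(i+1)`, `1 ≤ i ≤ ℓ`. -/
def simpleRootA (ℓ : ℕ) (i : Fin ℓ) : Module.Dual ℝ (spaceA ℓ) :=
  rootA ℓ i.castSucc i.succ

theorem rootA_ne_zero (ℓ : ℕ) {i j : Fin (ℓ + 1)} (hij : i ≠ j) : rootA ℓ i j ≠ 0 := fun h => by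
  have hmem : (Pi.single i (1 : ℝ) - Pi.single j (1 : ℝ) : Fin (ℓ + 1) → ℝ) ∈ spaceA ℓ := by
    simp [spaceA, coord, Finset.sum_sub_distrib]
  have h1 := LinearMap.congr_fun h ⟨_, hmem⟩
  simp [rootA, coord, hij, hij.symm] at h1

/-- The deformed Weyl arrangement `{α = k | α a positive root, k ∈ J}` of type `A_ℓ`. -/
def deformedWeylA (ℓ : ℕ) (J : Finset ℤ) : AffineArr (spaceA ℓ) where
  planes := {H | ∃ i j : Fin (ℓ + 1), i < j ∧ ∃ k ∈ J, H = {v | rootA ℓ i j v = (k : ℝ)}}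
  finite := by
    refine (Set.finite_iUnion fun i => Set.finite_iUnion fun j =>
      J.finite_toSet.image fun k : ℤ => {v : spaceA ℓ | rootA ℓ i j v = (k : ℝ)}).subset ?_
    rintro H ⟨i, j, -, k, hk, rfl⟩
    exact Set.mem_iUnion.2 ⟨i, Set.mem_iUnion.2 ⟨j, k, hk, rfl⟩⟩
  hyperplane := by
    rintro H ⟨i, j, hij, k, -, rfl⟩
    exact ⟨_, _, rootA_ne_zero ℓ hij.ne, rfl⟩

/-- The extended Catalan arrangement `Cat^m(A_ℓ)`. -/
def extCatalanA (ℓ m : ℕ) : AffineArr (spaceA ℓ) :=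
  deformedWeylA ℓ (Finset.Icc (-(m : ℤ)) (m : ℤ))

/-- A family `X` of subspaces of `spaceA ℓ × ℝ` (with `X d` in the role of the member of dimension
`d`) has the shape required of a simple root witness: there are simple roots `α_1, …, α_(ℓ-1)` and
integers `j_1, …, j_(ℓ-1)` such that, for `1 ≤ s ≤ ℓ - 1`, the member of codimension `s` is the
intersection of the hyperplanes `α_i = j_i z`, `1 ≤ i ≤ s`. -/
def IsSimpleRootFlag (ℓ : ℕ) (X : ℕ → Submodule ℝ (spaceA ℓ × ℝ)) : Prop :=
  ∃ (α : ℕ → Fin ℓ) (j : ℕ → ℤ), ∀ s, 1 ≤ s → s ≤ ℓ - 1 →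
    X (ℓ + 1 - s) = ⨅ i ∈ Finset.Icc 1 s, homogenize (simpleRootA ℓ (α i)) (j i : ℝ)

/-- For `1 ≤ d ≤ ℓ + 1`, the intersection of the first `ℓ + 1 - d` of the hyperplanes
`y_i - y_(i+1) = m z`, `1 ≤ i ≤ ℓ`. -/
def catalanFlag (ℓ m : ℕ) (d : ℕ) : Submodule ℝ (spaceA ℓ × ℝ) :=
  ⨅ i : Fin ℓ, ⨅ _ : (i : ℕ) < ℓ + 1 - d, homogenize (simpleRootA ℓ i) (m : ℝ)

/-- The linear forms `x_1` and `x_(i-1) - x_i`, `2 ≤ i ≤ ℓ`, with constants `-m` and `m`: the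
hyperplanes `x_1 = -m z` and `x_(i-1) - x_i = m z` in `ℝ^ℓ × ℝ`. -/
def flagPlaneE (ℓ m : ℕ) (i : Fin ℓ) : Submodule ℝ ((Fin ℓ → ℝ) × ℝ) :=
  if (i : ℕ) = 0 then homogenize (coord ℓ i) (-(m : ℝ))
  else homogenize (coord ℓ ⟨(i : ℕ) - 1, lt_of_le_of_lt (Nat.sub_le _ _) i.isLt⟩ - coord ℓ i)
    (m : ℝ)

/-- For `1 ≤ d ≤ ℓ + 1`, the intersection of the first `ℓ + 1 - d` of the hyperplanes
`x_1 = -m z`, `x_1 - x_2 = m z`, …, `x_(ℓ-1) - x_ℓ = m z`. -/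
def flagE (ℓ m : ℕ) (d : ℕ) : Submodule ℝ ((Fin ℓ → ℝ) × ℝ) :=
  ⨅ i : Fin ℓ, ⨅ _ : (i : ℕ) < ℓ + 1 - d, flagPlaneE ℓ m i

end

end HypArr

namespace HypArr

noncomputable section

/-! Everything reduces to central arrangements `weightArr`: the planes z = 0, x_i - x_j = kz with
|k| ≤ a, and x_i = kz with k in a finite weight set N_i. Deleting x_p = kz removes k from N_p.
Restricting to x_p = kz removes the coordinate p and adjoins [k-a, k+a] to every other weight, so
the class is closed under the operations needed.

Inductive freeness is a double induction. With L + 1 coordinates, start from empty weights, which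
are a pull-back from L coordinates with weights [-a, a]; then enlarge [1, w] to [1, w+1] one
coordinate at a time. Each restriction that occurs has the same interval as weight at all of its L
coordinates, whichever coordinates have already been enlarged. Its exponents are therefore constant
during a round, and a single moving exponent grows by one at each addition (`indFree_stepWeight`,
`fullStatement`).

For the flag, impose x_1 = -naz, x_2 = -(n+1)az, and so on. After t equations the remaining weights
are extended downwards to -(n+t)a, so the restriction is of type E again, with ℓ replaced by ℓ - t
and n by n + t. The shift m + a(ℓ+n-1) is unchanged. Since the coordinates with short weights are
eliminated first, the exponents are the initial segments of the sorted list
(`indFree_restriction_arrEFlag`).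

Actual homogeneous bases come from Terao's addition theorem, proved in coordinates
(`IsTupleBasis.addition`). The predicate `IndFree` carries exponents through the induction, so their
uniqueness is never required. The Catalan case is transported along x_i = y_(i+1) - y_1 by
`cone_eq_comap`. -/

/-! ### Homogeneous components and reduction modulo one variable. -/

open MvPolynomial in
theorem homogeneousComponent_mul_add {σ : Type*} {b q : MvPolynomial σ ℝ} {n : ℕ}
    (hb : b.IsHomogeneous n) (k : ℕ) :
    homogeneousComponent (n + k) (b * q) = b * homogeneousComponent k q := by
  let _ := MvPolynomial.gradedAlgebra (σ := σ) (R := ℝ)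
  have h := DirectSum.coe_decompose_mul_add_of_left_mem (homogeneousSubmodule σ ℝ) (i := n) (j := k)
    (a := b) (b := q) hb
  exact (decomposition.decompose'_apply _ _).symm.trans
    (h.trans (congrArg (b * ·) (decomposition.decompose'_apply _ _)))

open MvPolynomial in
theorem homogeneousComponent_mul_of_lt {σ : Type*} {b q : MvPolynomial σ ℝ} {n k : ℕ}
    (hb : b.IsHomogeneous n) (hk : k < n) : homogeneousComponent k (b * q) = 0 := by
  let _ := MvPolynomial.gradedAlgebra (σ := σ) (R := ℝ)
  have h := DirectSum.coe_decompose_mul_of_left_mem_of_not_le (homogeneousSubmodule σ ℝ) (i := n)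
    (n := k) (a := b) (b := q) hb (by omega)
  exact (decomposition.decompose'_apply _ _).symm.trans h

/-- Setting the first variable to zero. -/
def red (n : ℕ) : MvPolynomial (Fin (n + 1)) ℝ →ₐ[ℝ] MvPolynomial (Fin n) ℝ :=
  MvPolynomial.aeval (Fin.cases 0 MvPolynomial.X)

/-- The section of `red n` that inserts a variable. -/
def lift (n : ℕ) : MvPolynomial (Fin n) ℝ →ₐ[ℝ] MvPolynomial (Fin (n + 1)) ℝ :=
  MvPolynomial.rename Fin.succ

@[simp] theorem red_X_zero (n : ℕ) : red n (MvPolynomial.X 0) = 0 := by simp [red]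

@[simp] theorem red_X_succ (n : ℕ) (i : Fin n) :
    red n (MvPolynomial.X i.succ) = MvPolynomial.X i := by simp [red]

@[simp] theorem red_C (n : ℕ) (r : ℝ) : red n (MvPolynomial.C r) = MvPolynomial.C r := by
  simp [red, MvPolynomial.algebraMap_eq]

@[simp] theorem red_lift (n : ℕ) (f : MvPolynomial (Fin n) ℝ) : red n (lift n f) = f := by
  have : (red n).comp (lift n) = AlgHom.id ℝ _ := by
    ext i; simp [lift]
  exact DFunLike.congr_fun this f

theorem X_zero_dvd_sub_lift_red (n : ℕ) (f : MvPolynomial (Fin (n + 1)) ℝ) :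
    MvPolynomial.X 0 ∣ f - lift n (red n f) := by
  induction f using MvPolynomial.induction_on with
  | C a => simp [lift]
  | add p q hp hq =>
    rw [map_add, map_add, add_sub_add_comm]
    exact dvd_add hp hq
  | mul_X p i hp =>
    refine Fin.cases ?_ (fun j => ?_) i
    · simp
    · have : p * MvPolynomial.X j.succ - lift n (red n (p * MvPolynomial.X j.succ)) =
          (p - lift n (red n p)) * MvPolynomial.X j.succ := by
        simp [lift, sub_mul]
      rw [this]
      exact hp.mul_right _

theorem red_eq_zero_iff {n : ℕ} {f : MvPolynomial (Fin (n + 1)) ℝ} :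
    red n f = 0 ↔ MvPolynomial.X 0 ∣ f := by
  constructor
  · intro h
    simpa [h] using X_zero_dvd_sub_lift_red n f
  · rintro ⟨g, rfl⟩
    simp

theorem red_isHomogeneous {n d : ℕ} {f : MvPolynomial (Fin (n + 1)) ℝ} (hf : f.IsHomogeneous d) :
    (red n f).IsHomogeneous d := by
  have := hf.aeval (n := 1) (Fin.cases 0 MvPolynomial.X : Fin (n + 1) → MvPolynomial (Fin n) ℝ)
    (Fin.cases (MvPolynomial.isHomogeneous_zero _ _ _) fun _ => MvPolynomial.isHomogeneous_X _ _)
  rwa [one_mul] at this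

theorem lift_isHomogeneous {n d : ℕ} {f : MvPolynomial (Fin n) ℝ} (hf : f.IsHomogeneous d) :
    (lift n f).IsHomogeneous d := hf.rename_isHomogeneous

/-! ### Linear forms, derivations in coordinates, and change of basis. -/

namespace CentralArr

variable {V : Type u} [AddCommGroup V] [Module ℝ V]

section LinForm

variable {n : ℕ} (b : Module.Basis (Fin n) ℝ V)

theorem coeff_linForm (β : Module.Dual ℝ V) (i : Fin n) :
    (linForm b β).coeff (Finsupp.single i 1) = β (b i) := by
  classical
  simp [linForm, MvPolynomial.coeff_sum, MvPolynomial.coeff_C_mul, MvPolynomial.coeff_X,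
    Finsupp.single_left_inj]

theorem linForm_injective : Function.Injective (linForm b) := by
  intro β γ h
  refine b.ext fun i => ?_
  rw [← coeff_linForm, h, coeff_linForm]

theorem linForm_smul (c : ℝ) (β : Module.Dual ℝ V) :
    linForm b (c • β) = MvPolynomial.C c * linForm b β := by
  simp [linForm, Finset.mul_sum, mul_assoc]

theorem linForm_ne_zero {β : Module.Dual ℝ V} (hβ : β ≠ 0) : linForm b β ≠ 0 := by
  intro h
  refine hβ (linForm_injective b ?_)
  rw [h]
  simp [linForm]

theorem linForm_isHomogeneous (β : Module.Dual ℝ V) : (linForm b β).IsHomogeneous 1 :=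
  MvPolynomial.IsHomogeneous.sum _ _ _ fun _ _ => MvPolynomial.isHomogeneous_C_mul_X _ _

theorem linForm_irreducible {β : Module.Dual ℝ V} (hβ : β ≠ 0) : Irreducible (linForm b β) := by
  refine MvPolynomial.irreducible_of_totalDegree_eq_one
    ((linForm_isHomogeneous b β).totalDegree (linForm_ne_zero b hβ)) fun x hx => ?_
  obtain ⟨i, hi⟩ : ∃ i, β (b i) ≠ 0 := by
    by_contra! h
    exact hβ (b.ext fun i => by simp [h i])
  have := hx (Finsupp.single i 1)
  rw [coeff_linForm] at this
  refine isUnit_iff_ne_zero.2 ?_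
  rintro rfl
  exact hi (zero_dvd_iff.1 this)

/-- Comparing degrees, the quotient is a constant. Together with irreducibility this makes the forms
of distinct hyperplanes coprime. -/
theorem ker_eq_of_linForm_dvd {β γ : Module.Dual ℝ V} (hβ : β ≠ 0) (hγ : γ ≠ 0)
    (h : linForm b β ∣ linForm b γ) : LinearMap.ker β = LinearMap.ker γ := by
  obtain ⟨q, hq⟩ := h
  have hβ' := linForm_ne_zero b hβ
  have hγ' := linForm_ne_zero b hγ
  have hq0 : q ≠ 0 := by
    rintro rfl
    exact hγ' (by rw [hq, mul_zero])
  have hd := MvPolynomial.totalDegree_mul_of_isDomain hβ' hq0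
  rw [← hq, (linForm_isHomogeneous b β).totalDegree hβ',
    (linForm_isHomogeneous b γ).totalDegree hγ'] at hd
  have hqC := MvPolynomial.totalDegree_eq_zero_iff_eq_C.1 (show q.totalDegree = 0 by omega)
  set c := q.coeff 0
  have hc : c ≠ 0 := by
    intro hc
    rw [hc, map_zero] at hqC
    exact hq0 hqC
  have hγβ : γ = c • β := by
    refine linForm_injective b ?_
    rw [linForm_smul, hq, mul_comm, ← hqC]
  rw [hγβ, LinearMap.ker_smul _ _ hc]

end LinForm

/-- The value on the linear form `β` of the derivation with coordinates `v`. -/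
def pair {n : ℕ} (b : Module.Basis (Fin n) ℝ V) (β : Module.Dual ℝ V)
    (v : Fin n → MvPolynomial (Fin n) ℝ) : MvPolynomial (Fin n) ℝ :=
  ∑ i, MvPolynomial.C (β (b i)) * v i

section Pair

variable {n : ℕ} (b : Module.Basis (Fin n) ℝ V) (β : Module.Dual ℝ V)

theorem pair_add (v w : Fin n → MvPolynomial (Fin n) ℝ) :
    pair b β (v + w) = pair b β v + pair b β w := by
  simp [pair, mul_add, Finset.sum_add_distrib]

theorem pair_smul (f : MvPolynomial (Fin n) ℝ) (v : Fin n → MvPolynomial (Fin n) ℝ) :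
    pair b β (f • v) = f * pair b β v := by
  simp [pair, Finset.mul_sum, mul_left_comm]

theorem derivation_linForm
    (θ : Derivation ℝ (MvPolynomial (Fin n) ℝ) (MvPolynomial (Fin n) ℝ)) :
    θ (linForm b β) = pair b β fun i => θ (MvPolynomial.X i) := by
  simp [linForm, pair, MvPolynomial.C_mul', map_sum]

end Pair

/-- The module of derivations of `A` in terms of coordinates. -/
def tupleDer (A : CentralArr V) {n : ℕ} (b : Module.Basis (Fin n) ℝ V) :
    Submodule (MvPolynomial (Fin n) ℝ) (Fin n → MvPolynomial (Fin n) ℝ) where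
  carrier := {v | ∀ β : Module.Dual ℝ V, LinearMap.ker β ∈ A.planes →
    linForm b β ∣ pair b β v}
  add_mem' hv hw β hβ := by rw [pair_add]; exact dvd_add (hv β hβ) (hw β hβ)
  zero_mem' β _ := by simp [pair]
  smul_mem' f v hv β hβ := by rw [pair_smul]; exact (hv β hβ).mul_left f

/-- `θ` is a homogeneous basis, with degrees `d`, of the module of derivations of `A`. -/
structure IsTupleBasis (A : CentralArr V) {n : ℕ} (b : Module.Basis (Fin n) ℝ V) (d : Fin n → ℕ)
    (θ : Fin n → Fin n → MvPolynomial (Fin n) ℝ) : Prop where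
  mem : ∀ i, θ i ∈ A.tupleDer b
  homogeneous : ∀ i j, (θ i j).IsHomogeneous (d i)
  independent : ∀ c : Fin n → MvPolynomial (Fin n) ℝ, ∑ i, c i • θ i = 0 → ∀ i, c i = 0
  spanning : ∀ v ∈ A.tupleDer b, ∃ c : Fin n → MvPolynomial (Fin n) ℝ, v = ∑ i, c i • θ i

/-- A derivation of a polynomial ring is determined by its values on the variables, and these can be
prescribed freely, so tuples and derivations are interchangeable. -/
theorem IsTupleBasis.hasExponents {A : CentralArr V} {n : ℕ} {b : Module.Basis (Fin n) ℝ V}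
    {d : Fin n → ℕ} {θ : Fin n → Fin n → MvPolynomial (Fin n) ℝ} (h : A.IsTupleBasis b d θ) :
    A.HasExponents (Finset.univ.val.map d) := by
  let Θ : Fin n → A.der b := fun i => ⟨MvPolynomial.mkDerivation ℝ (θ i), fun β hβ => by
    rw [derivation_linForm]
    simpa [MvPolynomial.mkDerivation_X] using h.mem i β hβ⟩
  have hΘ : ∀ (c : Fin n → MvPolynomial (Fin n) ℝ) (j : Fin n),
      ((∑ i, c i • Θ i : A.der b) : Derivation ℝ (MvPolynomial (Fin n) ℝ) _)
        (MvPolynomial.X j) = (∑ i, c i • θ i) j := by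
    intro c j
    have hs : ∀ s : Finset (Fin n), ((∑ i ∈ s, c i • Θ i : A.der b) : Derivation ℝ
        (MvPolynomial (Fin n) ℝ) _) (MvPolynomial.X j) = (∑ i ∈ s, c i • θ i) j := by
      classical
      intro s
      induction s using Finset.induction_on with
      | empty => simp
      | insert i s hi ih =>
        rw [Finset.sum_insert hi, Finset.sum_insert hi, Submodule.coe_add, Derivation.add_apply,
          ih]
        simp [Θ, MvPolynomial.mkDerivation_X]
    exact hs _
  have hli : LinearIndependent (MvPolynomial (Fin n) ℝ) Θ := by
    refine Fintype.linearIndependent_iffₛ.2 fun c c' hc i => ?_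
    refine sub_eq_zero.1 (h.independent (fun i => c i - c' i) ?_ i)
    simp only [sub_smul, Finset.sum_sub_distrib, sub_eq_zero]
    ext1 j
    rw [← hΘ, hc, hΘ]
  have hsp : ⊤ ≤ Submodule.span (MvPolynomial (Fin n) ℝ) (Set.range Θ) := by
    rintro ⟨η, hη⟩ -
    obtain ⟨c, hc⟩ := h.spanning (fun i => η (MvPolynomial.X i)) fun β hβ => by
      rw [← derivation_linForm]
      exact hη β hβ
    refine (Submodule.mem_span_range_iff_exists_fun _).2 ⟨c, Subtype.ext ?_⟩
    refine MvPolynomial.derivation_ext fun j => ?_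
    rw [hΘ, ← hc]
  refine ⟨n, b, Module.Basis.mk hli hsp, d, fun i j => ?_, rfl⟩
  simpa [Θ, MvPolynomial.mkDerivation_X] using h.homogeneous i j

section ChangeOfBasis

variable {n : ℕ} (b b' : Module.Basis (Fin n) ℝ V)

theorem sum_dual_mul_repr (β : Module.Dual ℝ V) (v : V) : ∑ i, β (b i) * b.repr v i = β v := by
  conv_rhs => rw [← b.sum_repr v, map_sum]
  exact Finset.sum_congr rfl fun i _ => by rw [map_smul, smul_eq_mul, mul_comm]

/-- The change of coordinates of polynomial functions. -/
def changeVar : MvPolynomial (Fin n) ℝ →ₐ[ℝ] MvPolynomial (Fin n) ℝ :=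
  MvPolynomial.aeval fun i => linForm b' (b.coord i)

theorem changeVar_linForm (β : Module.Dual ℝ V) :
    changeVar b b' (linForm b β) = linForm b' β := by
  have : linForm b' β = ∑ i, MvPolynomial.C (β (b i)) * linForm b' (b.coord i) := by
    simp only [linForm, Finset.mul_sum]
    rw [Finset.sum_comm]
    refine Finset.sum_congr rfl fun j _ => ?_
    rw [← sum_dual_mul_repr b β (b' j)]
    simp [map_sum, Finset.sum_mul, mul_assoc]
  rw [this]
  simp [linForm, changeVar, MvPolynomial.algebraMap_eq]

theorem changeVar_changeVar (f : MvPolynomial (Fin n) ℝ) :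
    changeVar b' b (changeVar b b' f) = f := by
  have : (changeVar b' b).comp (changeVar b b') = AlgHom.id ℝ _ := by
    ext i : 1
    have h : (MvPolynomial.X i : MvPolynomial (Fin n) ℝ) = linForm b (b.coord i) := by
      simp [linForm, Finsupp.single_apply, apply_ite MvPolynomial.C]
    rw [AlgHom.comp_apply, h, changeVar_linForm, changeVar_linForm]
    rfl
  exact DFunLike.congr_fun this f

theorem changeVar_isHomogeneous {f : MvPolynomial (Fin n) ℝ} {d : ℕ} (hf : f.IsHomogeneous d) :
    (changeVar b b' f).IsHomogeneous d := by
  have := hf.aeval (n := 1) (fun i => linForm b' (b.coord i)) fun i => linForm_isHomogeneous b' _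
  rwa [one_mul] at this

/-- The change of coordinates of derivations. -/
def changeTuple (v : Fin n → MvPolynomial (Fin n) ℝ) : Fin n → MvPolynomial (Fin n) ℝ :=
  fun j => ∑ i, MvPolynomial.C (b'.coord j (b i)) * changeVar b b' (v i)

/-- Evaluation on linear forms commutes with the change of coordinates; this is what carries the
divisibility conditions from one basis to another. -/
theorem pair_changeTuple (β : Module.Dual ℝ V) (v : Fin n → MvPolynomial (Fin n) ℝ) :
    pair b' β (changeTuple b b' v) = changeVar b b' (pair b β v) := by
  simp only [pair, changeTuple, Finset.mul_sum, map_sum, map_mul]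
  rw [Finset.sum_comm]
  refine Finset.sum_congr rfl fun i _ => ?_
  rw [← sum_dual_mul_repr b' β (b i)]
  simp [map_sum, Finset.sum_mul, mul_assoc, changeVar, MvPolynomial.algebraMap_eq]

theorem changeTuple_changeTuple (v : Fin n → MvPolynomial (Fin n) ℝ) :
    changeTuple b' b (changeTuple b b' v) = v := by
  ext1 j
  have h : ∀ w : Fin n → MvPolynomial (Fin n) ℝ, w j = pair b (b.coord j) w := by
    intro w
    simp [pair, Finsupp.single_apply, apply_ite MvPolynomial.C]
  rw [h (changeTuple _ _ _), pair_changeTuple, pair_changeTuple, changeVar_changeVar, ← h]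

theorem changeTuple_sum_smul {ι : Type*} (s : Finset ι) (c : ι → MvPolynomial (Fin n) ℝ)
    (θ : ι → Fin n → MvPolynomial (Fin n) ℝ) :
    changeTuple b b' (∑ i ∈ s, c i • θ i) =
      ∑ i ∈ s, changeVar b b' (c i) • changeTuple b b' (θ i) := by
  ext1 j
  simp only [changeTuple, Finset.sum_apply, Pi.smul_apply, smul_eq_mul, map_sum, map_mul,
    Finset.mul_sum]
  rw [Finset.sum_comm]
  exact Finset.sum_congr rfl fun i _ => Finset.sum_congr rfl fun k _ => by ring

theorem changeTuple_mem {A : CentralArr V} {v : Fin n → MvPolynomial (Fin n) ℝ}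
    (hv : v ∈ A.tupleDer b) : changeTuple b b' v ∈ A.tupleDer b' := by
  intro β hβ
  rw [pair_changeTuple, ← changeVar_linForm b b' β]
  exact map_dvd _ (hv β hβ)

variable {b} in
theorem IsTupleBasis.changeBasis {A : CentralArr V} {d : Fin n → ℕ}
    {θ : Fin n → Fin n → MvPolynomial (Fin n) ℝ} (h : A.IsTupleBasis b d θ) :
    A.IsTupleBasis b' d fun i => changeTuple b b' (θ i) where
  mem i := changeTuple_mem b b' (h.mem i)
  homogeneous i j := by
    refine MvPolynomial.IsHomogeneous.sum _ _ _ fun k _ => ?_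
    exact (changeVar_isHomogeneous b b' (h.homogeneous i k)).C_mul _
  independent c hc i := by
    have := congrArg (changeTuple b' b) hc
    rw [changeTuple_sum_smul] at this
    simp only [changeTuple_changeTuple] at this
    have h0 : changeTuple b' b 0 = 0 := by ext1 j; simp [changeTuple]
    have := h.independent _ (this.trans h0) i
    rw [← changeVar_changeVar b' b (c i), this, map_zero]
  spanning v hv := by
    obtain ⟨c, hc⟩ := h.spanning _ (changeTuple_mem b' b hv)
    refine ⟨fun i => changeVar b b' (c i), ?_⟩
    rw [← changeTuple_changeTuple b' b v, hc, changeTuple_sum_smul]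

end ChangeOfBasis

end CentralArr

/-! ### Adapted bases and reduction of derivations to a hyperplane. -/

theorem exists_eq_smul_of_ker_le {V : Type*} [AddCommGroup V] [Module ℝ V]
    {α γ : Module.Dual ℝ V} (h : LinearMap.ker α ≤ LinearMap.ker γ) : ∃ c : ℝ, γ = c • α := by
  by_cases hα : α = 0
  · refine ⟨0, ?_⟩
    rw [hα, LinearMap.ker_zero, top_le_iff, LinearMap.ker_eq_top] at h
    simp [h]
  · obtain ⟨y, hy⟩ := LinearMap.surjective hα 1
    refine ⟨γ y, LinearMap.ext fun v => ?_⟩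
    have : v - α v • y ∈ LinearMap.ker γ := h (by simp [hy])
    rw [LinearMap.mem_ker, map_sub, map_smul, sub_eq_zero] at this
    rw [this, LinearMap.smul_apply, smul_eq_mul, smul_eq_mul, mul_comm]

namespace CentralArr

variable {V : Type u} [AddCommGroup V] [Module ℝ V]

theorem eq_of_mem_of_le (A : CentralArr V) {H K : Submodule ℝ V} (hH : H ∈ A.planes)
    (hK : K ∈ A.planes) (hle : H ≤ K) : H = K := by
  obtain ⟨α, hα, rfl⟩ := A.hyperplane H hH
  obtain ⟨γ, hγ, rfl⟩ := A.hyperplane K hK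
  obtain ⟨c, rfl⟩ := exists_eq_smul_of_ker_le hle
  rw [LinearMap.ker_smul _ _ (by rintro rfl; simp at hγ)]

/-- Any form of K restricts to a nonzero multiple of δ, so it can be rescaled. Planes with the same
trace on H thereby get defining forms that agree on H. -/
theorem exists_extend_form (A : CentralArr V) {H K : Submodule ℝ V} (hK : K ∈ A.planes)
    (hHK : ¬ H ≤ K) {δ : Module.Dual ℝ H} (hδ : LinearMap.ker δ = K.comap H.subtype) :
    ∃ γ : Module.Dual ℝ V, LinearMap.ker γ = K ∧ γ.comp H.subtype = δ := by
  obtain ⟨γ, hγ, rfl⟩ := A.hyperplane K hK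
  obtain ⟨c, hc⟩ : ∃ c : ℝ, δ = c • γ.comp H.subtype :=
    exists_eq_smul_of_ker_le (by rw [hδ]; rfl)
  have hc0 : c ≠ 0 := by
    rintro rfl
    rw [zero_smul] at hc
    rw [hc, LinearMap.ker_zero] at hδ
    refine hHK fun x hx => ?_
    have : (⟨x, hx⟩ : H) ∈ (LinearMap.ker γ).comap H.subtype := hδ ▸ Submodule.mem_top
    exact this
  exact ⟨c • γ, LinearMap.ker_smul _ _ hc0, by rw [hc]; rfl⟩

/-- `b` is a basis of `V` consisting of a vector at which `α` takes the value `1` and of the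
basis `bH` of the kernel `H` of `α`. -/
structure IsAdapted {n : ℕ} (α : Module.Dual ℝ V) (H : Submodule ℝ V)
    (b : Module.Basis (Fin (n + 1)) ℝ V) (bH : Module.Basis (Fin n) ℝ H) : Prop where
  ker_eq : LinearMap.ker α = H
  apply_zero : α (b 0) = 1
  succ_eq : ∀ i, b (Fin.succ i) = bH i

theorem exists_isAdapted {n : ℕ} {α : Module.Dual ℝ V} (hα : α ≠ 0) {H : Submodule ℝ V}
    (hH : LinearMap.ker α = H) (bH : Module.Basis (Fin n) ℝ H) :
    ∃ b : Module.Basis (Fin (n + 1)) ℝ V, IsAdapted α H b bH := by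
  obtain ⟨y, hy⟩ := LinearMap.surjective hα 1
  refine ⟨Module.Basis.mkFinCons y bH (fun c x hx h => ?_) (fun z => ⟨-α z, ?_⟩), hH, ?_, ?_⟩
  · rw [← hH, LinearMap.mem_ker] at hx
    simpa [hx, hy] using congrArg α h
  · simp [← hH, hy]
  · simpa [Module.Basis.coe_mkFinCons] using hy
  · intro i
    simp [Module.Basis.coe_mkFinCons]

/-- The derivation induced on the hyperplane. -/
def redTuple {n : ℕ} (v : Fin (n + 1) → MvPolynomial (Fin (n + 1)) ℝ) :
    Fin n → MvPolynomial (Fin n) ℝ := fun i => red n (v i.succ)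

namespace IsAdapted

variable {n : ℕ} {α : Module.Dual ℝ V} {H : Submodule ℝ V}
  {b : Module.Basis (Fin (n + 1)) ℝ V} {bH : Module.Basis (Fin n) ℝ H}

theorem apply_succ (h : IsAdapted α H b bH) (i : Fin n) : α (b i.succ) = 0 := by
  rw [h.succ_eq, ← LinearMap.mem_ker, h.ker_eq]
  exact (bH i).2

theorem linForm_eq (h : IsAdapted α H b bH) : linForm b α = MvPolynomial.X 0 := by
  simp [linForm, Fin.sum_univ_succ, h.apply_zero, h.apply_succ]

theorem pair_eq (h : IsAdapted α H b bH) (v : Fin (n + 1) → MvPolynomial (Fin (n + 1)) ℝ) :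
    pair b α v = v 0 := by
  simp [pair, Fin.sum_univ_succ, h.apply_zero, h.apply_succ]

theorem linForm_eq_add (h : IsAdapted α H b bH) (γ : Module.Dual ℝ V) :
    linForm b γ = MvPolynomial.C (γ (b 0)) * MvPolynomial.X 0 +
      lift n (linForm bH (γ.comp H.subtype)) := by
  simp [linForm, Fin.sum_univ_succ, h.succ_eq, lift]

theorem red_linForm (h : IsAdapted α H b bH) (γ : Module.Dual ℝ V) :
    red n (linForm b γ) = linForm bH (γ.comp H.subtype) := by
  simp [h.linForm_eq_add]

theorem pair_eq_add (h : IsAdapted α H b bH) (γ : Module.Dual ℝ V)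
    (v : Fin (n + 1) → MvPolynomial (Fin (n + 1)) ℝ) :
    pair b γ v = MvPolynomial.C (γ (b 0)) * v 0 +
      ∑ i, MvPolynomial.C ((γ.comp H.subtype) (bH i)) * v i.succ := by
  simp [pair, Fin.sum_univ_succ, h.succ_eq]

theorem ker_linForm_ne (h : IsAdapted α H b bH) {γ : Module.Dual ℝ V} (hγ : γ ≠ 0)
    (hH : ¬ H ≤ LinearMap.ker γ) : ¬ linForm b γ ∣ MvPolynomial.X 0 := by
  intro hdvd
  rw [← h.linForm_eq] at hdvd
  have hα : α ≠ 0 := by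
    rintro rfl
    simpa using h.apply_zero
  rw [ker_eq_of_linForm_dvd b hγ hα hdvd, h.ker_eq] at hH
  exact hH le_rfl

/-- In adapted coordinates α is the variable x_0 and the value at α is the component 0, so the
condition for H is a single divisibility. -/
theorem mem_tupleDer_iff (h : IsAdapted α H b bH) {A : CentralArr V} (hH : H ∈ A.planes)
    {v : Fin (n + 1) → MvPolynomial (Fin (n + 1)) ℝ} :
    v ∈ A.tupleDer b ↔ v ∈ (A.deletion H).tupleDer b ∧ MvPolynomial.X 0 ∣ v 0 := by
  constructor
  · intro hv
    refine ⟨fun β hβ => hv β hβ.1, ?_⟩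
    have := hv α (h.ker_eq ▸ hH)
    rwa [h.linForm_eq, h.pair_eq] at this
  · rintro ⟨hv, hv0⟩ β hβ
    by_cases hβH : LinearMap.ker β = H
    · obtain ⟨c, rfl⟩ := exists_eq_smul_of_ker_le (h.ker_eq.trans hβH.symm).le
      have hp : pair b (c • α) v = MvPolynomial.C c * v 0 := by
        rw [← h.pair_eq v]
        simp [pair, Finset.mul_sum, mul_assoc]
      rw [linForm_smul, h.linForm_eq, hp]
      exact mul_dvd_mul_left _ hv0
    · exact hv β ⟨hβ, hβH⟩

/-- The component 0 dies modulo α, so each divisibility by a form γ on V reduces to the divisibility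
by the restriction of γ to H. -/
theorem redTuple_mem (h : IsAdapted α H b bH) {A : CentralArr V} (hH : H ∈ A.planes)
    {v : Fin (n + 1) → MvPolynomial (Fin (n + 1)) ℝ} (hv : v ∈ A.tupleDer b) :
    redTuple v ∈ (A.restriction H).tupleDer bH := by
  rintro δ ⟨K, hK, hHK, hδ⟩
  obtain ⟨γ, hγK, rfl⟩ := A.exists_extend_form hK hHK hδ
  have hdvd := map_dvd (red n) (hv γ (hγK ▸ hK))
  have h0 := red_eq_zero_iff.2 ((h.mem_tupleDer_iff hH).1 hv).2
  rw [h.red_linForm, h.pair_eq_add, map_add, map_mul, h0, mul_zero, zero_add, map_sum] at hdvd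
  simpa [pair, redTuple] using hdvd

/-- The values at `α` of the derivations of `A` are, modulo `α`, divisible by a polynomial whose
degree is the number of hyperplanes of `A` minus the number of their traces on `H = ker α`. -/
theorem exists_dvd_red (h : IsAdapted α H b bH) (A : CentralArr V)
    (hA : ∀ K ∈ A.planes, ¬ H ≤ K) :
    ∃ (x : ℕ) (B : MvPolynomial (Fin n) ℝ), B ≠ 0 ∧ B.IsHomogeneous x ∧
      A.planes.ncard = (A.restriction H).planes.ncard + x ∧
      ∀ v ∈ A.tupleDer b, B ∣ red n (v 0) := by
  classical
  set r : Submodule ℝ V → Submodule ℝ H := fun K => K.comap H.subtype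
  set P := A.finite.toFinset
  have hP : ∀ K, K ∈ P ↔ K ∈ A.planes := fun K => by simp [P]
  have hQ : (A.restriction H).planes = (P.image r : Finset (Submodule ℝ H)) := by
    ext X
    simp only [restriction, Set.mem_ofPred_eq, Finset.coe_image, Set.mem_image, SetLike.mem_coe, hP]
    constructor
    · rintro ⟨K, hK, -, rfl⟩
      exact ⟨K, hK, rfl⟩
    · rintro ⟨K, hK, rfl⟩
      exact ⟨K, hK, hA K hK, rfl⟩
  have hδ : ∀ X : Submodule ℝ H, ∃ δ : Module.Dual ℝ H, X ∈ P.image r →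
      δ ≠ 0 ∧ LinearMap.ker δ = X := by
    intro X
    by_cases hX : X ∈ P.image r
    · have hX' : X ∈ (A.restriction H).planes := by rw [hQ]; exact hX
      obtain ⟨δ, h1, h2⟩ := (A.restriction H).hyperplane X hX'
      exact ⟨δ, fun _ => ⟨h1, h2.symm⟩⟩
    · exact ⟨0, fun h => absurd h hX⟩
  choose δ hδ using hδ
  have hγ : ∀ K : Submodule ℝ V, ∃ γ : Module.Dual ℝ V, K ∈ P →
      LinearMap.ker γ = K ∧ γ.comp H.subtype = δ (r K) := by
    intro K
    by_cases hK : K ∈ P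
    · obtain ⟨γ, h1, h2⟩ := A.exists_extend_form ((hP K).1 hK) (hA K ((hP K).1 hK))
        (hδ (r K) (Finset.mem_image_of_mem r hK)).2
      exact ⟨γ, fun _ => ⟨h1, h2⟩⟩
    · exact ⟨0, fun h => absurd h hK⟩
  choose γ hγ using hγ
  have hγ0 : ∀ K ∈ P, γ K ≠ 0 := by
    intro K hK h0
    refine hA K ((hP K).1 hK) ?_
    rw [← (hγ K hK).1, h0, LinearMap.ker_zero]
    exact le_top
  set k : Submodule ℝ H → ℕ := fun X => (P.filter fun K => r K = X).card
  have hk : ∀ X ∈ P.image r, 1 ≤ k X := by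
    intro X hX
    obtain ⟨K, hK, rfl⟩ := Finset.mem_image.1 hX
    exact Finset.card_pos.2 ⟨K, Finset.mem_filter.2 ⟨hK, rfl⟩⟩
  -- Terao's polynomial: each trace X enters with one less than the number of planes cutting it out.
  refine ⟨∑ X ∈ P.image r, (k X - 1), ∏ X ∈ P.image r, linForm bH (δ X) ^ (k X - 1), ?_, ?_, ?_, ?_⟩
  · exact Finset.prod_ne_zero_iff.2 fun X hX => pow_ne_zero _ (linForm_ne_zero bH (hδ X hX).1)
  · refine MvPolynomial.IsHomogeneous.prod _ _ _ fun X _ => ?_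
    simpa using (linForm_isHomogeneous bH (δ X)).pow (k X - 1)
  · rw [hQ, Set.ncard_coe_finset, Set.ncard_eq_toFinset_card _ A.finite]
    change P.card = _
    rw [Finset.card_eq_sum_card_image r P, Finset.card_eq_sum_ones, ← Finset.sum_add_distrib]
    exact Finset.sum_congr rfl fun X hX => by have := hk X hX; simp only [k] at this ⊢; omega
  · intro v hv
    refine Finset.prod_dvd_of_isRelPrime ?_ ?_
    · intro X hX Y hY hXY
      refine IsRelPrime.pow ?_
      refine ((linForm_irreducible bH (hδ X hX).1).isRelPrime_iff_not_dvd).2 fun hd => hXY ?_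
      have := ker_eq_of_linForm_dvd bH (hδ X hX).1 (hδ Y hY).1 hd
      rwa [(hδ X hX).2, (hδ Y hY).2] at this
    · intro X hX
      set F := P.filter fun K => r K = X
      set Q := ∑ i, MvPolynomial.C (δ X (bH i)) * v i.succ
      -- For K over X, γ_K = t x_0 + δ_X and its value on v is t v_0 + Q, with t depending on K.
      -- Eliminating t shows that δ_X v_0 - x_0 Q is divisible by every γ_K, hence by their product
      -- since they are pairwise coprime.
      have h1 : ∏ K ∈ F, linForm b (γ K) ∣
          lift n (linForm bH (δ X)) * v 0 - MvPolynomial.X 0 * Q := by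
        refine Finset.prod_dvd_of_isRelPrime ?_ ?_
        · intro K hK L hL hKL
          have hK' := (Finset.mem_filter.1 hK).1
          have hL' := (Finset.mem_filter.1 hL).1
          refine ((linForm_irreducible b (hγ0 K hK')).isRelPrime_iff_not_dvd).2 fun hd => hKL ?_
          have := ker_eq_of_linForm_dvd b (hγ0 K hK') (hγ0 L hL') hd
          rwa [(hγ K hK').1, (hγ L hL').1] at this
        · intro K hK
          obtain ⟨hK, hKX⟩ := Finset.mem_filter.1 hK
          have hd := hv (γ K) (by rw [(hγ K hK).1]; exact (hP K).1 hK)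
          rw [h.pair_eq_add, (hγ K hK).2, hKX] at hd
          have : lift n (linForm bH (δ X)) * v 0 - MvPolynomial.X 0 * Q =
              linForm b (γ K) * v 0 -
                MvPolynomial.X 0 * (MvPolynomial.C ((γ K) (b 0)) * v 0 + Q) := by
            rw [h.linForm_eq_add, (hγ K hK).2, hKX]
            ring
          rw [this]
          exact dvd_sub (dvd_mul_right _ _) (hd.mul_left _)
      -- At x_0 = 0 all the γ_K become δ_X, so δ_X^k divides δ_X v_0; one factor cancels.
      have h2 := map_dvd (red n) h1
      have h3 : red n (∏ K ∈ F, linForm b (γ K)) = linForm bH (δ X) ^ k X := by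
        rw [map_prod]
        refine Finset.prod_eq_pow_card fun K hK => ?_
        obtain ⟨hK, hKX⟩ := Finset.mem_filter.1 hK
        rw [h.red_linForm, (hγ K hK).2, hKX]
      rw [h3, map_sub, map_mul, map_mul, red_lift, red_X_zero, zero_mul, sub_zero] at h2
      have h4 : k X = k X - 1 + 1 := by have := hk X hX; omega
      rw [h4, pow_succ'] at h2
      exact (mul_dvd_mul_iff_left (linForm_ne_zero bH (hδ X hX).1)).1 h2

end IsAdapted

end CentralArr

/-! ### Terao's addition theorem. -/

/-- Over a nontrivial commutative ring an independent family cannot outnumber a finite set whose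
span contains it. The relation is extended by zero outside I. -/
theorem exists_relation_of_card_lt {R M ι : Type*} [CommRing R] [Nontrivial R] [AddCommGroup M]
    [Module R M] [Fintype ι] (v : ι → M) (I : Finset ι) (t : Finset M)
    (hv : ∀ i ∈ I, v i ∈ Submodule.span R (t : Set M)) (hcard : t.card < I.card) :
    ∃ g : ι → R, (∀ i ∉ I, g i = 0) ∧ ∑ i, g i • v i = 0 ∧ ∃ i, g i ≠ 0 := by
  classical
  have hnot : ¬ LinearIndepOn R v (I : Set ι) := by
    intro hli
    have h := linearIndependent_le_span_aux' _ hli (t : Set M) (by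
      rintro _ ⟨i, rfl⟩
      exact hv i i.2)
    simp only [Finset.coe_sort_coe, Fintype.card_coe] at h
    omega
  rw [linearIndepOn_finset_iff] at hnot
  push Not at hnot
  obtain ⟨f, hf, i, hi, hfi⟩ := hnot
  refine ⟨fun i => if i ∈ I then f i else 0, fun i hi => by simp [hi], ?_, i, by simpa [hi]⟩
  simpa [ite_smul, Finset.sum_ite_mem] using hf

theorem eq_zero_of_dvd_of_lt {σ : Type*} {B f : MvPolynomial σ ℝ} {x d : ℕ}
    (hB : B.IsHomogeneous x) (hf : f.IsHomogeneous d) (h : B ∣ f) (hd : d < x) : f = 0 := by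
  obtain ⟨q, rfl⟩ := h
  rw [← MvPolynomial.homogeneousComponent_eq_self hf]
  exact homogeneousComponent_mul_of_lt hB hd

theorem exists_isHomogeneous_of_dvd {σ : Type*} {B f : MvPolynomial σ ℝ} {x k : ℕ}
    (hB : B.IsHomogeneous x) (hf : f.IsHomogeneous (x + k)) (h : B ∣ f) :
    ∃ q : MvPolynomial σ ℝ, q.IsHomogeneous k ∧ f = B * q := by
  obtain ⟨q, rfl⟩ := h
  refine ⟨_, MvPolynomial.homogeneousComponent_isHomogeneous k q, ?_⟩
  rw [← homogeneousComponent_mul_add hB, MvPolynomial.homogeneousComponent_eq_self hf]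

namespace CentralArr

variable {V : Type u} [AddCommGroup V] [Module ℝ V]

namespace IsTupleBasis

/-- A homogeneous derivation is a combination of basis derivations of at most its own degree. -/
theorem mem_span_of_homogeneous {A : CentralArr V} {n : ℕ} {b : Module.Basis (Fin n) ℝ V}
    {d : Fin n → ℕ} {φ : Fin n → Fin n → MvPolynomial (Fin n) ℝ} (h : A.IsTupleBasis b d φ)
    {v : Fin n → MvPolynomial (Fin n) ℝ} (hv : v ∈ A.tupleDer b) {k : ℕ}
    (hk : ∀ j, (v j).IsHomogeneous k) (J : Finset (Fin n)) (hJ : ∀ j, d j ≤ k → j ∈ J) :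
    v ∈ Submodule.span (MvPolynomial (Fin n) ℝ) (φ '' J) := by
  obtain ⟨c, hc⟩ := h.spanning v hv
  have hv' : v = ∑ j, (if d j ≤ k then MvPolynomial.homogeneousComponent (k - d j) (c j) else 0) •
      φ j := by
    -- Taking the component of degree k of the expansion of v leaves only the summands with d j ≤ k.
    ext1 i
    rw [← MvPolynomial.homogeneousComponent_eq_self (hk i)]
    conv_lhs => rw [hc]
    simp only [Finset.sum_apply, map_sum, Pi.smul_apply, smul_eq_mul]
    refine Finset.sum_congr rfl fun j _ => ?_
    rw [mul_comm]
    split_ifs with hj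
    · obtain ⟨m, rfl⟩ := Nat.exists_eq_add_of_le hj
      rw [homogeneousComponent_mul_add (h.homogeneous j i), Nat.add_sub_cancel_left, mul_comm]
    · rw [homogeneousComponent_mul_of_lt (h.homogeneous j i) (by omega), zero_mul]
  rw [hv']
  refine Submodule.sum_mem _ fun j _ => ?_
  split_ifs with hj
  · exact Submodule.smul_mem _ _ (Submodule.subset_span ⟨j, hJ j hj, rfl⟩)
  · rw [zero_smul]
    exact Submodule.zero_mem _

variable {n : ℕ} {α : Module.Dual ℝ V} {H : Submodule ℝ V}
  {b : Module.Basis (Fin (n + 1)) ℝ V} {bH : Module.Basis (Fin n) ℝ H}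
  {A : CentralArr V} {d : Fin (n + 1) → ℕ} {θ : Fin (n + 1) → Fin (n + 1) →
    MvPolynomial (Fin (n + 1)) ℝ}

/-- The basis exchange in the addition theorem. -/
theorem exchange (hb : IsAdapted α H b bH) (hH : H ∈ A.planes)
    (hθ : (A.deletion H).IsTupleBasis b d θ) {i₀ : Fin (n + 1)}
    {h : Fin (n + 1) → MvPolynomial (Fin (n + 1)) ℝ} (hi₀ : red n (θ i₀ 0) ≠ 0) (h0 : h i₀ = 0)
    (hh : ∀ j ≠ i₀, red n (θ j 0) = red n (h j) * red n (θ i₀ 0))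
    (hhom : ∀ j k, (h j * θ i₀ k).IsHomogeneous (d j)) :
    A.IsTupleBasis b (Function.update d i₀ (d i₀ + 1)) fun j =>
      (if j = i₀ then MvPolynomial.X 0 else 1 : MvPolynomial (Fin (n + 1)) ℝ) • θ j -
        h j • θ i₀ := by
  classical
  set u : Fin (n + 1) → MvPolynomial (Fin (n + 1)) ℝ := fun j =>
    if j = i₀ then MvPolynomial.X 0 else 1
  -- The change of family is triangular: apart from the factor u j, only the coefficient of θ i₀
  -- changes, by the sum of the c k * h k.
  have hsum : ∀ c : Fin (n + 1) → MvPolynomial (Fin (n + 1)) ℝ,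
      ∑ j, c j • (u j • θ j - h j • θ i₀) =
        ∑ j, (c j * u j - Pi.single (M := fun _ => MvPolynomial (Fin (n + 1)) ℝ) i₀
          (∑ k, c k * h k) j) • θ j := by
    intro c
    simp only [smul_sub, sub_smul, Finset.sum_sub_distrib, smul_smul]
    congr 1
    rw [← Finset.sum_smul]
    symm
    rw [Finset.sum_eq_single i₀]
    · simp
    · intro j _ hj
      simp [hj]
    · simp
  refine ⟨fun j => ?_, fun j k => ?_, fun c hc => ?_, fun v hv => ?_⟩
  · rw [hb.mem_tupleDer_iff hH]
    refine ⟨Submodule.sub_mem _ (Submodule.smul_mem _ _ (hθ.mem j))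
      (Submodule.smul_mem _ _ (hθ.mem i₀)), red_eq_zero_iff.1 ?_⟩
    simp only [Pi.sub_apply, Pi.smul_apply, smul_eq_mul, map_sub, map_mul]
    by_cases hj : j = i₀
    · subst hj
      simp [h0]
    · simp [hj, hh j hj]
  · simp only [Pi.sub_apply, Pi.smul_apply, smul_eq_mul]
    by_cases hj : j = i₀
    · subst hj
      simpa [u, h0, add_comm] using (MvPolynomial.isHomogeneous_X ℝ 0).mul (hθ.homogeneous j k)
    · simpa [u, hj] using (hθ.homogeneous j k).sub (hhom j k)
  · rw [hsum] at hc
    have hc' := hθ.independent _ hc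
    have h1 : ∀ j ≠ i₀, c j = 0 := fun j hj => by simpa [u, hj] using hc' j
    have h2 : ∑ k, c k * h k = 0 := by
      refine Finset.sum_eq_zero fun k _ => ?_
      by_cases hk : k = i₀
      · rw [hk, h0, mul_zero]
      · rw [h1 k hk, zero_mul]
    intro j
    by_cases hj : j = i₀
    · have := hc' j
      rw [h2] at this
      simpa [u, hj, MvPolynomial.X_ne_zero] using this
    · exact h1 j hj
  · obtain ⟨hv', hv0⟩ := (hb.mem_tupleDer_iff hH).1 hv
    obtain ⟨a, ha⟩ := hθ.spanning v hv'
    -- All reduced components 0 are multiples of that of θ i₀, so x_0 divides this combination of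
    -- coefficients. The quotient is the coefficient of the new element x_0 • θ i₀.
    have hred : red n (a i₀ + ∑ k, a k * h k) * red n (θ i₀ 0) = 0 := by
      rw [← red_eq_zero_iff.2 hv0, ha]
      simp only [Finset.sum_apply, Pi.smul_apply, smul_eq_mul, map_sum, map_mul, map_add]
      rw [← Finset.add_sum_erase _ _ (Finset.mem_univ i₀),
        ← Finset.add_sum_erase (a := i₀) _ (fun k => red n (a k) * red n (θ k 0))
          (Finset.mem_univ i₀), h0, map_zero, mul_zero, zero_add, add_mul, Finset.sum_mul]
      congr 1
      refine Finset.sum_congr rfl fun j hj => ?_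
      rw [hh j (Finset.ne_of_mem_erase hj), mul_assoc]
    obtain ⟨q, hq⟩ := red_eq_zero_iff.1 ((mul_eq_zero.1 hred).resolve_right hi₀)
    refine ⟨Function.update a i₀ q, ?_⟩
    rw [hsum, ha]
    refine Finset.sum_congr rfl fun j _ => ?_
    have hs : ∑ k, Function.update a i₀ q k * h k = ∑ k, a k * h k := by
      refine Finset.sum_congr rfl fun k _ => ?_
      by_cases hk : k = i₀
      · rw [hk, h0, mul_zero, mul_zero]
      · rw [Function.update_of_ne hk]
    rw [hs]
    congr 1
    by_cases hj : j = i₀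
    · subst hj
      simp only [Function.update_self, Pi.single_eq_same, u, if_true]
      rw [mul_comm, ← hq]
      ring
    · simp [u, hj]

/-- Terao's addition theorem in coordinates. -/
theorem addition (hb : IsAdapted α H b bH) (hH : H ∈ A.planes)
    (hθ : (A.deletion H).IsTupleBasis b d θ) {d'' : Fin n → ℕ}
    {φ : Fin n → Fin n → MvPolynomial (Fin n) ℝ} (hφ : (A.restriction H).IsTupleBasis bH d'' φ)
    {x : ℕ} (hd : Finset.univ.val.map d = x ::ₘ Finset.univ.val.map d'')
    (hcard : (A.deletion H).planes.ncard = (A.restriction H).planes.ncard + x) :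
    ∃ d₁ θ₁, A.IsTupleBasis b d₁ θ₁ ∧
      Finset.univ.val.map d₁ = (x + 1) ::ₘ Finset.univ.val.map d'' := by
  classical
  have hdelH : ∀ K ∈ (A.deletion H).planes, ¬ H ≤ K := fun K hK hle =>
    hK.2 (A.eq_of_mem_of_le hH hK.1 hle).symm
  have hres : (A.deletion H).restriction H = A.restriction H := by
    ext X
    constructor
    · rintro ⟨K, hK, hle, rfl⟩
      exact ⟨K, hK.1, hle, rfl⟩
    · rintro ⟨K, hK, hle, rfl⟩
      exact ⟨K, ⟨hK, fun h => hle (h ▸ le_rfl)⟩, hle, rfl⟩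
  obtain ⟨y, B, hB0, hBy, hcardy, hdvd⟩ := hb.exists_dvd_red _ hdelH
  obtain rfl : y = x := by rw [hres] at hcardy; omega
  have hf : ∀ i, (red n (θ i 0)).IsHomogeneous (d i) := fun i =>
    red_isHomogeneous (hθ.homogeneous i 0)
  -- Write f_i for the reduced component 0 of θ i. All f_i are multiples of B, which has degree y,
  -- so a nonzero f_i of degree y generates all the others.
  by_cases hex : ∃ i, d i = y ∧ red n (θ i 0) ≠ 0
  · obtain ⟨i₀, hdi, hi₀⟩ := hex
    obtain ⟨q, hq, hfq⟩ := exists_isHomogeneous_of_dvd (k := 0) hBy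
      (by simpa [hdi] using hf i₀) (hdvd _ (hθ.mem i₀))
    obtain ⟨c, rfl⟩ : ∃ c, q = MvPolynomial.C c :=
      ⟨_, MvPolynomial.totalDegree_eq_zero_iff_eq_C.1
        ((MvPolynomial.totalDegree_zero_iff_isHomogeneous _).2 hq)⟩
    have hc : c ≠ 0 := by
      rintro rfl
      rw [map_zero, mul_zero] at hfq
      exact hi₀ hfq
    have hh : ∀ j, ∃ h : MvPolynomial (Fin (n + 1)) ℝ, (j = i₀ → h = 0) ∧
        (j ≠ i₀ → red n (θ j 0) = red n h * red n (θ i₀ 0)) ∧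
        ∀ k, (h * θ i₀ k).IsHomogeneous (d j) := by
      intro j
      by_cases hj : j = i₀
      · exact ⟨0, fun _ => rfl, fun h => absurd hj h, fun k => by
          simpa using MvPolynomial.isHomogeneous_zero _ _ _⟩
      rcases lt_or_ge (d j) y with hlt | hge
      · refine ⟨0, fun _ => rfl, fun _ => ?_, fun k => by
          simpa using MvPolynomial.isHomogeneous_zero _ _ _⟩
        rw [eq_zero_of_dvd_of_lt hBy (hf j) (hdvd _ (hθ.mem j)) hlt, map_zero, zero_mul]
      · obtain ⟨k, hk⟩ := Nat.exists_eq_add_of_le hge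
        obtain ⟨q, hq, hjq⟩ := exists_isHomogeneous_of_dvd (k := k) hBy
          (by rw [← hk]; exact hf j) (hdvd _ (hθ.mem j))
        -- Here f_j = B q and f_(i₀) = B c with c a nonzero constant, so the multiplier is q / c, of
        -- degree d j - y.
        refine ⟨lift n (MvPolynomial.C c⁻¹ * q), fun h => absurd h hj, fun _ => ?_, fun l => ?_⟩
        · rw [red_lift, hfq, hjq]
          have : (MvPolynomial.C c⁻¹ : MvPolynomial (Fin n) ℝ) * MvPolynomial.C c = 1 := by
            rw [← map_mul, inv_mul_cancel₀ hc, map_one]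
          linear_combination (-B * q) * this
        · have := (lift_isHomogeneous (hq.C_mul c⁻¹)).mul (hθ.homogeneous i₀ l)
          rwa [hdi, Nat.add_comm k y, ← hk] at this
    choose h h0 h1 h2 using hh
    refine ⟨_, _, exchange hb hH hθ hi₀ (h0 i₀ rfl) h1 h2, ?_⟩
    have hu : ∀ f : Fin (n + 1) → ℕ, Finset.univ.val.map f =
        f i₀ ::ₘ (Finset.univ.erase i₀).val.map f := by
      intro f
      rw [← Multiset.map_cons f, ← Finset.insert_val_of_notMem (Finset.notMem_erase _ _),
        Finset.insert_erase (Finset.mem_univ _)]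
    rw [hu, hdi, Multiset.cons_inj_right] at hd
    rw [hu, Function.update_self, hdi, ← hd]
    congr 1
    refine Multiset.map_congr rfl fun j hj => ?_
    rw [Function.update_of_ne (Finset.ne_of_mem_erase (Finset.mem_def.2 hj))]
  · exfalso
    push Not at hex
    -- Below degree y, divisibility by B forces f_i = 0; in degree y this is the negated case
    -- assumption.
    have hmem : ∀ i, d i ≤ y → θ i ∈ A.tupleDer b := by
      intro i hi
      refine (hb.mem_tupleDer_iff hH).2 ⟨hθ.mem i, red_eq_zero_iff.1 ?_⟩
      rcases hi.lt_or_eq with hlt | heq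
      · exact eq_zero_of_dvd_of_lt hBy (hf i) (hdvd _ (hθ.mem i)) hlt
      · exact hex i heq
    set I := Finset.univ.filter fun i => d i ≤ y
    set J := Finset.univ.filter fun j => d'' j ≤ y
    -- The exponents of the deletion contain the extra value y, so there is one more θ i of degree
    -- at most y than there are φ j to span the reductions.
    have hIJ : I.card = J.card + 1 := by
      have := congrArg (Multiset.countP (· ≤ y)) hd
      rw [Multiset.countP_cons_of_pos (p := (· ≤ y)) _ le_rfl, Multiset.countP_map,
        Multiset.countP_map] at this
      exact this
    obtain ⟨g, hg, hsum, i, hgi⟩ := exists_relation_of_card_lt (R := MvPolynomial (Fin n) ℝ)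
      (fun i => redTuple (θ i)) I (J.image φ) (fun i hi => by
        have hi' := (Finset.mem_filter.1 hi).2
        rw [Finset.coe_image]
        exact hφ.mem_span_of_homogeneous (hb.redTuple_mem hH (hmem i hi'))
          (fun j => red_isHomogeneous (hθ.homogeneous i _)) J fun j hj =>
            Finset.mem_filter.2 ⟨Finset.mem_univ _, hj.trans hi'⟩)
      (lt_of_le_of_lt Finset.card_image_le (by omega))
    -- The relation on H lifts to a combination of the θ i divisible by x_0. The quotient η is still
    -- a derivation of the deletion, since no form of the deletion divides x_0. Independence then
    -- makes each lifted coefficient divisible by x_0, so every g i vanishes.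
    have hw : ∀ k, MvPolynomial.X 0 ∣ (∑ i, lift n (g i) • θ i) k := by
      intro k
      refine red_eq_zero_iff.1 ?_
      simp only [Finset.sum_apply, Pi.smul_apply, smul_eq_mul, map_sum, map_mul, red_lift]
      refine Fin.cases ?_ (fun k => ?_) k
      · refine Finset.sum_eq_zero fun i _ => ?_
        by_cases hi : i ∈ I
        · have := ((hb.mem_tupleDer_iff hH).1 (hmem i (Finset.mem_filter.1 hi).2)).2
          rw [red_eq_zero_iff.2 this, mul_zero]
        · rw [hg i hi, zero_mul]
      · simpa [redTuple] using congrFun hsum k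
    choose η hη using hw
    have hη' : ∑ i, lift n (g i) • θ i = (MvPolynomial.X 0 : MvPolynomial (Fin (n + 1)) ℝ) • η :=
      funext hη
    have hηmem : η ∈ (A.deletion H).tupleDer b := by
      intro β hβ
      have h1 : (∑ i, lift n (g i) • θ i) ∈ (A.deletion H).tupleDer b :=
        Submodule.sum_mem _ fun i _ => Submodule.smul_mem _ _ (hθ.mem i)
      have h2 := h1 β hβ
      rw [hη', pair_smul] at h2
      have hβ0 : β ≠ 0 := by
        rintro rfl
        exact hdelH _ hβ (by simp)
      exact ((linForm_irreducible b hβ0).prime.dvd_or_dvd h2).resolve_left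
        (hb.ker_linForm_ne hβ0 (hdelH _ hβ))
    obtain ⟨c, hc⟩ := hθ.spanning η hηmem
    have hz := hθ.independent (fun i => lift n (g i) - MvPolynomial.X 0 * c i) (by
      simp only [sub_smul, Finset.sum_sub_distrib, mul_smul]
      rw [hη', hc, Finset.smul_sum, sub_self]) i
    refine hgi ?_
    rw [← red_lift n (g i), sub_eq_zero.1 hz, map_mul, red_X_zero, zero_mul]

end IsTupleBasis

end CentralArr

/-! ### Inductive freeness with exponents. -/

/-- Inductively free arrangements together with their exponents. -/
inductive IndFree :
    ∀ {V : Type u} [AddCommGroup V] [Module ℝ V], CentralArr V → Multiset ℕ → Prop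
  | empty {V : Type u} [AddCommGroup V] [Module ℝ V] [FiniteDimensional ℝ V]
      (A : CentralArr V) (hA : A.planes = ∅) :
      IndFree A (Multiset.replicate (Module.finrank ℝ V) 0)
  | addition {V : Type u} [AddCommGroup V] [Module ℝ V] (A : CentralArr V)
      (H : Submodule ℝ V) (hH : H ∈ A.planes) (x : ℕ) (e : Multiset ℕ)
      (hdel : IndFree (A.deletion H) (x ::ₘ e))
      (hres : IndFree (A.restriction H) e) : IndFree A ((x + 1) ::ₘ e)

namespace IndFree

open CentralArr

theorem finiteDimensional {V : Type u} [AddCommGroup V] [Module ℝ V] {A : CentralArr V}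
    {e : Multiset ℕ} (h : IndFree A e) : FiniteDimensional ℝ V := by
  induction h with
  | empty A hA => assumption
  | addition A H hH x e hdel hres ih ih' => exact ih

/-- An addition step raises both sides by one. This supplies the count of hyperplanes required by
the addition theorem. -/
theorem ncard_planes {V : Type u} [AddCommGroup V] [Module ℝ V] {A : CentralArr V}
    {e : Multiset ℕ} (h : IndFree A e) : A.planes.ncard = e.sum := by
  induction h with
  | empty A hA => simp [hA]
  | addition A H hH x e hdel hres ih ih' =>
    have h1 : (A.deletion H).planes.ncard + 1 = A.planes.ncard :=
      Set.ncard_sdiff_singleton_add_one hH A.finite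
    rw [← h1, ih, Multiset.sum_cons, Multiset.sum_cons]
    omega

/-- The basis of V is arbitrary because an addition step needs coordinates adapted to H; afterwards
the result is moved to the given basis. -/
theorem exists_isTupleBasis {V : Type u} [AddCommGroup V] [Module ℝ V] {A : CentralArr V}
    {e : Multiset ℕ} (h : IndFree A e) {n : ℕ} (b : Module.Basis (Fin n) ℝ V) :
    ∃ d θ, A.IsTupleBasis b d θ ∧ Finset.univ.val.map d = e := by
  induction h generalizing n with
  | empty A hA =>
    refine ⟨fun _ => 0, fun i => Pi.single i 1, ⟨fun i β hβ => ?_, fun i j => ?_, fun c hc i => ?_,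
      fun v _ => ⟨v, ?_⟩⟩, ?_⟩
    · simp [hA] at hβ
    · by_cases hij : j = i
      · subst hij
        simpa using MvPolynomial.isHomogeneous_one _ _
      · simpa [hij] using MvPolynomial.isHomogeneous_zero _ _ _
    · have := congrFun hc i
      simpa [Finset.sum_apply, Pi.single_apply] using this
    · ext1 i
      simp [Finset.sum_apply, Pi.single_apply]
    · rw [Module.finrank_eq_card_basis b]
      simp
  | @addition V _ _ A H hH x e hdel hres ih ih' =>
    have := hdel.finiteDimensional
    obtain ⟨α, hα, hHα⟩ := A.hyperplane H hH
    obtain ⟨b', hb'⟩ := exists_isAdapted hα hHα.symm (Module.finBasis ℝ H)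
    obtain rfl : n = Module.finrank ℝ H + 1 := by
      have h1 := Module.finrank_eq_card_basis b
      have h2 := Module.finrank_eq_card_basis b'
      rw [Fintype.card_fin] at h1 h2
      exact h1.symm.trans h2
    obtain ⟨d, θ, hθ, hd⟩ := ih b'
    obtain ⟨d'', φ, hφ, hd''⟩ := ih' (Module.finBasis ℝ H)
    obtain ⟨d₁, θ₁, hθ₁, hd₁⟩ := hθ.addition hb' hH hφ (by rw [hd, hd''])
      (by rw [hdel.ncard_planes, hres.ncard_planes, Multiset.sum_cons, add_comm])
    exact ⟨d₁, _, hθ₁.changeBasis b, by rw [hd₁, hd'']⟩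

theorem hasExponents {V : Type u} [AddCommGroup V] [Module ℝ V] {A : CentralArr V}
    {e : Multiset ℕ} (h : IndFree A e) : A.HasExponents e := by
  have := h.finiteDimensional
  obtain ⟨d, θ, hθ, rfl⟩ := h.exists_isTupleBasis (Module.finBasis ℝ V)
  exact hθ.hasExponents

theorem isInductivelyFree {V : Type u} [AddCommGroup V] [Module ℝ V] {A : CentralArr V}
    {e : Multiset ℕ} (h : IndFree A e) : IsInductivelyFree A := by
  induction h with
  | empty A hA => exact .empty A hA
  | addition A H hH x e hdel hres ih ih' =>
    exact .addition A H hH _ _ ih ih' hdel.hasExponents hres.hasExponents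
      (Multiset.le_cons_self _ _)

end IndFree

/-! ### Pull-backs along surjective linear maps. -/

namespace CentralArr

variable {V W : Type u} [AddCommGroup V] [Module ℝ V] [AddCommGroup W] [Module ℝ W]

/-- The preimage of an arrangement under a surjective linear map. -/
def comap (A : CentralArr V) (f : W →ₗ[ℝ] V) (hf : Function.Surjective f) : CentralArr W where
  planes := Submodule.comap f '' A.planes
  finite := A.finite.image _
  hyperplane := by
    rintro _ ⟨H, hH, rfl⟩
    obtain ⟨α, hα, rfl⟩ := A.hyperplane H hH
    refine ⟨α.comp f, fun h0 => hα (LinearMap.ext fun v => ?_), rfl⟩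
    obtain ⟨w, rfl⟩ := hf v
    exact LinearMap.congr_fun h0 w

/-- The restriction of a linear map to the preimage of a subspace. -/
def comapMap (f : W →ₗ[ℝ] V) (X : Submodule ℝ V) : X.comap f →ₗ[ℝ] X :=
  f.restrict fun _ hw => hw

theorem comapMap_surjective {f : W →ₗ[ℝ] V} (hf : Function.Surjective f) (X : Submodule ℝ V) :
    Function.Surjective (comapMap f X) := by
  rintro ⟨x, hx⟩
  obtain ⟨w, rfl⟩ := hf x
  exact ⟨⟨w, hx⟩, rfl⟩

theorem comap_deletion (A : CentralArr V) {f : W →ₗ[ℝ] V} (hf : Function.Surjective f)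
    (H : Submodule ℝ V) :
    (A.comap f hf).deletion (H.comap f) = (A.deletion H).comap f hf := by
  ext K
  constructor
  · rintro ⟨⟨L, hL, rfl⟩, hne⟩
    exact ⟨L, ⟨hL, fun h => hne (by rw [Set.mem_singleton_iff.1 h]; rfl)⟩, rfl⟩
  · rintro ⟨L, ⟨hL, hne⟩, rfl⟩
    exact ⟨⟨L, hL, rfl⟩, fun h => hne (Submodule.comap_injective_of_surjective hf h)⟩

theorem comap_restriction (A : CentralArr V) {f : W →ₗ[ℝ] V} (hf : Function.Surjective f)
    (X : Submodule ℝ V) :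
    (A.comap f hf).restriction (X.comap f) =
      (A.restriction X).comap (comapMap f X) (comapMap_surjective hf X) := by
  ext K
  constructor
  · rintro ⟨_, ⟨L, hL, rfl⟩, hle, rfl⟩
    exact ⟨_, ⟨L, hL, fun h => hle (Submodule.comap_mono h), rfl⟩, rfl⟩
  · rintro ⟨_, ⟨L, hL, hle, rfl⟩, rfl⟩
    exact ⟨_, ⟨L, hL, rfl⟩, fun h => hle ((Submodule.comap_le_comap_iff_of_surjective hf).1 h), rfl⟩

end CentralArr

/-- Pull-back commutes with deletion and restriction, so the induction is copied verbatim; the k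
kernel dimensions contribute exponents 0 in the empty case. -/
theorem IndFree.comap {V W : Type u} [AddCommGroup V] [Module ℝ V] [AddCommGroup W] [Module ℝ W]
    [FiniteDimensional ℝ W] {A : CentralArr V} {e : Multiset ℕ} (h : IndFree A e) (f : W →ₗ[ℝ] V)
    (hf : Function.Surjective f) {k : ℕ} (hk : Module.finrank ℝ W = Module.finrank ℝ V + k) :
    IndFree (A.comap f hf) (e + Multiset.replicate k 0) := by
  induction h generalizing W with
  | empty A hA =>
    rw [← Multiset.replicate_add, ← hk]
    exact .empty _ (by simp [CentralArr.comap, hA])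
  | @addition V _ _ A H hH x e hdel hres ih ih' =>
    have := hdel.finiteDimensional
    rw [Multiset.cons_add]
    refine .addition (A.comap f hf) (H.comap f) ⟨H, hH, rfl⟩ x _ ?_ ?_
    · rw [CentralArr.comap_deletion, ← Multiset.cons_add]
      exact ih f hf hk
    · rw [CentralArr.comap_restriction]
      refine ih' _ _ ?_
      obtain ⟨α, hα, rfl⟩ := A.hyperplane H hH
      have h1 := Module.Dual.finrank_ker_add_one_of_ne_zero hα
      have hα' : α.comp f ≠ 0 := by
        intro h0
        refine hα (LinearMap.ext fun v => ?_)
        obtain ⟨w, rfl⟩ := hf v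
        exact LinearMap.congr_fun h0 w
      have h2 := Module.Dual.finrank_ker_add_one_of_ne_zero hα'
      have h3 : (LinearMap.ker α).comap f = LinearMap.ker (α.comp f) := rfl
      rw [h3]
      omega

theorem IndFree.comapEquiv {V W : Type u} [AddCommGroup V] [Module ℝ V] [AddCommGroup W]
    [Module ℝ W] {A : CentralArr V} {e : Multiset ℕ} (h : IndFree A e) (f : W ≃ₗ[ℝ] V) :
    IndFree (A.comap f.toLinearMap f.surjective) e := by
  have := h.finiteDimensional
  have := f.symm.finiteDimensional
  simpa using h.comap f.toLinearMap f.surjective (k := 0) f.finrank_eq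

/-! ### Weighted arrangements: deletion, restriction, translation. -/

section Planes

variable {ι : Type}

/-- The coordinate function `x_i`. -/
def coordForm (i : ι) : Module.Dual ℝ (ι → ℝ) := LinearMap.proj i

/-- The hyperplane `x_i = k z`. -/
def coordPlane (i : ι) (k : ℤ) : Submodule ℝ ((ι → ℝ) × ℝ) :=
  homogenize (coordForm i) (k : ℝ)

/-- The hyperplane `x_i - x_j = k z`. -/
def diffPlane (i j : ι) (k : ℤ) : Submodule ℝ ((ι → ℝ) × ℝ) :=
  homogenize (coordForm i - coordForm j) (k : ℝ)

theorem mem_coordPlane {i : ι} {k : ℤ} {w : (ι → ℝ) × ℝ} :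
    w ∈ coordPlane i k ↔ w.1 i = k * w.2 := mem_homogenize _ _ _

theorem mem_diffPlane {i j : ι} {k : ℤ} {w : (ι → ℝ) × ℝ} :
    w ∈ diffPlane i j k ↔ w.1 i - w.1 j = k * w.2 := mem_homogenize _ _ _

theorem mem_planeAtInfinity {V : Type u} [AddCommGroup V] [Module ℝ V] {w : V × ℝ} :
    w ∈ planeAtInfinity V ↔ w.2 = 0 := by simp [planeAtInfinity]

theorem homogenize_hyperplane {V : Type u} [AddCommGroup V] [Module ℝ V] {α : Module.Dual ℝ V}
    (hα : α ≠ 0) (c : ℝ) : ∃ β : Module.Dual ℝ (V × ℝ), β ≠ 0 ∧ homogenize α c = LinearMap.ker β :=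
  ⟨_, fun h => hα (LinearMap.ext fun v => by simpa using LinearMap.congr_fun h (v, (0 : ℝ))), rfl⟩

/-- The planes `z = 0`, `x_i - x_j = k z` for `-a ≤ k ≤ a`, and `x_i = k z` for `k ∈ N i`. -/
def weightPlanes (ι : Type) (a : ℕ) (N : ι → Finset ℤ) : Set (Submodule ℝ ((ι → ℝ) × ℝ)) :=
  {K | K = planeAtInfinity (ι → ℝ) ∨
    (∃ i j, i ≠ j ∧ ∃ k ∈ Finset.Icc (-(a : ℤ)) a, K = diffPlane i j k) ∨
    ∃ i, ∃ k ∈ N i, K = coordPlane i k}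

/-- The central arrangement with the planes `z = 0`, `x_i - x_j = k z` for `-a ≤ k ≤ a`, and
`x_i = k z` for `k ∈ N i`. -/
def weightArr (ι : Type) [Finite ι] (a : ℕ) (N : ι → Finset ℤ) : CentralArr ((ι → ℝ) × ℝ) where
  planes := weightPlanes ι a N
  finite := by
    refine ((Set.finite_singleton (planeAtInfinity (ι → ℝ))).union
      ((Set.finite_iUnion fun i => Set.finite_iUnion fun j =>
        (Finset.Icc (-(a : ℤ)) a).finite_toSet.image (diffPlane (ι := ι) i j)).union
      (Set.finite_iUnion fun i => (N i).finite_toSet.image (coordPlane i)))).subset ?_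
    rintro K (rfl | ⟨i, j, -, k, hk, rfl⟩ | ⟨i, k, hk, rfl⟩)
    · exact Or.inl rfl
    · exact Or.inr (Or.inl (Set.mem_iUnion.2 ⟨i, Set.mem_iUnion.2 ⟨j, k, hk, rfl⟩⟩))
    · exact Or.inr (Or.inr (Set.mem_iUnion.2 ⟨i, k, hk, rfl⟩))
  hyperplane := by
    classical
    rintro K (rfl | ⟨i, j, hij, k, hk, rfl⟩ | ⟨i, k, hk, rfl⟩)
    · refine ⟨LinearMap.snd ℝ (ι → ℝ) ℝ, fun h => ?_, rfl⟩
      simpa using LinearMap.congr_fun h ((0 : ι → ℝ), (1 : ℝ))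
    · refine homogenize_hyperplane (fun h => ?_) _
      simpa [coordForm, hij.symm] using LinearMap.congr_fun h (Pi.single i 1)
    · refine homogenize_hyperplane (fun h => ?_) _
      simpa [coordForm] using LinearMap.congr_fun h (Pi.single i 1)

theorem mem_weightArr [Finite ι] {a : ℕ} {N : ι → Finset ℤ} {K : Submodule ℝ ((ι → ℝ) × ℝ)} :
    K ∈ (weightArr ι a N).planes ↔ K = planeAtInfinity (ι → ℝ) ∨
      (∃ i j, i ≠ j ∧ ∃ k ∈ Finset.Icc (-(a : ℤ)) a, K = diffPlane i j k) ∨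
      ∃ i, ∃ k ∈ N i, K = coordPlane i k := Iff.rfl

theorem coordPlane_ne_planeAtInfinity (p : ι) (k : ℤ) :
    coordPlane p k ≠ planeAtInfinity (ι → ℝ) := by
  intro h
  have h1 : ((fun _ => (k : ℝ), 1) : (ι → ℝ) × ℝ) ∈ coordPlane p k := by simp [mem_coordPlane]
  rw [h, mem_planeAtInfinity] at h1
  exact one_ne_zero h1

theorem coordPlane_ne_diffPlane (p : ι) {i j : ι} (hij : i ≠ j) (k l : ℤ) :
    coordPlane p k ≠ diffPlane i j l := by
  classical
  intro h
  by_cases hi : p = i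
  · have h1 : ((Pi.single j 1, 0) : (ι → ℝ) × ℝ) ∈ coordPlane p k := by
      simp [mem_coordPlane, hi, hij]
    rw [h, mem_diffPlane] at h1
    simp [hij] at h1
  · have h1 : ((Pi.single i 1, 0) : (ι → ℝ) × ℝ) ∈ coordPlane p k := by
      simp [mem_coordPlane, hi]
    rw [h, mem_diffPlane] at h1
    simp [hij.symm] at h1

theorem coordPlane_inj {p i : ι} {k l : ℤ} (h : coordPlane p k = coordPlane i l) :
    p = i ∧ k = l := by
  classical
  by_cases hi : p = i
  · refine ⟨hi, ?_⟩
    have h1 : ((fun _ => (k : ℝ), 1) : (ι → ℝ) × ℝ) ∈ coordPlane p k := by simp [mem_coordPlane]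
    rw [h, mem_coordPlane] at h1
    simpa using h1
  · have h1 : ((Pi.single i 1, 0) : (ι → ℝ) × ℝ) ∈ coordPlane p k := by
      simp [mem_coordPlane, hi]
    rw [h, mem_coordPlane] at h1
    simp at h1

theorem weightArr_deletion [Finite ι] (a : ℕ) {N N' : ι → Finset ℤ} (p : ι) (k : ℤ)
    (hN : ∀ i l, l ∈ N' i ↔ l ∈ N i ∧ ¬ (i = p ∧ l = k)) :
    (weightArr ι a N).deletion (coordPlane p k) = weightArr ι a N' := by
  ext K
  constructor
  · rintro ⟨rfl | ⟨i, j, hij, l, hl, rfl⟩ | ⟨i, l, hl, rfl⟩, hne⟩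
    · exact Or.inl rfl
    · exact Or.inr (Or.inl ⟨i, j, hij, l, hl, rfl⟩)
    · refine Or.inr (Or.inr ⟨i, l, (hN i l).2 ⟨hl, ?_⟩, rfl⟩)
      rintro ⟨rfl, rfl⟩
      exact hne rfl
  · rintro (rfl | ⟨i, j, hij, l, hl, rfl⟩ | ⟨i, l, hl, rfl⟩)
    · exact ⟨Or.inl rfl, fun h => coordPlane_ne_planeAtInfinity p k h.symm⟩
    · exact ⟨Or.inr (Or.inl ⟨i, j, hij, l, hl, rfl⟩),
        fun h => coordPlane_ne_diffPlane p hij k l h.symm⟩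
    · obtain ⟨h1, h2⟩ := (hN i l).1 hl
      exact ⟨Or.inr (Or.inr ⟨i, l, h1, rfl⟩), fun h => h2 (coordPlane_inj h)⟩

/-- The subspace `x_i = c_i z` for the indices `i` satisfying `S`. -/
def fixSpace (S : ι → Prop) (c : ι → ℤ) : Submodule ℝ ((ι → ℝ) × ℝ) :=
  ⨅ i, ⨅ _ : S i, coordPlane i (c i)

theorem mem_fixSpace {S : ι → Prop} {c : ι → ℤ} {w : (ι → ℝ) × ℝ} :
    w ∈ fixSpace S c ↔ ∀ i, S i → w.1 i = c i * w.2 := by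
  simp [fixSpace, mem_coordPlane]

open Classical in
/-- The free coordinates on the subspace `x_i = c_i z`, `S i`. -/
def fixSpaceEquiv (S : ι → Prop) (c : ι → ℤ) :
    fixSpace S c ≃ₗ[ℝ] ({i // ¬ S i} → ℝ) × ℝ where
  toFun w := (fun i => w.1.1 i, w.1.2)
  map_add' _ _ := rfl
  map_smul' _ _ := rfl
  invFun y := ⟨(fun i => if h : S i then c i * y.2 else y.1 ⟨i, h⟩, y.2), by
    rw [mem_fixSpace]
    intro i hi
    simp [hi]⟩
  left_inv w := by
    refine Subtype.ext (Prod.ext (funext fun i => ?_) rfl)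
    by_cases hi : S i
    · simp [hi, mem_fixSpace.1 w.2 i hi]
    · simp [hi]
  right_inv y := by
    refine Prod.ext (funext fun i => ?_) rfl
    simp [i.2]

/-- Putting x_i = c_i z into x_j - x_i = kz gives x_j = (c_i + k)z, so a fixed coordinate i adjoins
c_i + [-a, a] to each free weight. Planes involving fixed coordinates only become z = 0 or contain
the subspace. -/
theorem weightArr_restriction_fixSpace [Finite ι] (a : ℕ) {N : ι → Finset ℤ} (S : ι → Prop)
    (c : ι → ℤ) {N' : {i // ¬ S i} → Finset ℤ}
    (hN : ∀ j k, k ∈ N' j ↔ k ∈ N j ∨ ∃ i, S i ∧ k - c i ∈ Finset.Icc (-(a : ℤ)) a) :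
    (weightArr ι a N).restriction (fixSpace S c) =
      (weightArr {i // ¬ S i} a N').comap (fixSpaceEquiv S c).toLinearMap
        (fixSpaceEquiv S c).surjective := by
  set f := fixSpaceEquiv S c
  have hw : ∀ (w : fixSpace S c) (i : ι), S i → w.1.1 i = c i * w.1.2 := fun w =>
    mem_fixSpace.1 w.2
  have hf1 : ∀ (w : fixSpace S c) (i : {i // ¬ S i}), (f w).1 i = w.1.1 i := fun _ _ => rfl
  have hf2 : ∀ w : fixSpace S c, (f w).2 = w.1.2 := fun _ => rfl
  -- A plane that reads tz = 0 on the subspace has trace z = 0: t ≠ 0 because the plane does not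
  -- contain the subspace.
  have hinf : ∀ (L : Submodule ℝ ((ι → ℝ) × ℝ)) (t : ℝ), ¬ fixSpace S c ≤ L →
      (∀ w : fixSpace S c, w.1 ∈ L ↔ t * w.1.2 = 0) →
      L.comap (fixSpace S c).subtype = (planeAtInfinity _).comap f.toLinearMap := by
    intro L t hL ht
    have ht0 : t ≠ 0 := by
      rintro rfl
      exact hL fun w hw => (ht ⟨w, hw⟩).2 (zero_mul _)
    ext w
    rw [Submodule.mem_comap, Submodule.mem_comap, mem_planeAtInfinity]
    exact (ht w).trans (by rw [mul_eq_zero, or_iff_right ht0]; rfl)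
  ext K
  constructor
  · rintro ⟨L, hL, hle, rfl⟩
    obtain rfl | ⟨i, j, hij, k, hk, rfl⟩ | ⟨i, k, hk, rfl⟩ := mem_weightArr.1 hL
    · exact ⟨_, Or.inl rfl, (hinf _ 1 hle fun w => by rw [mem_planeAtInfinity, one_mul]).symm⟩
    · rw [Finset.mem_Icc] at hk
      by_cases hi : S i <;> by_cases hj : S j
      · refine ⟨_, Or.inl rfl, (hinf _ ((c i : ℝ) - c j - k) hle fun w => ?_).symm⟩
        rw [mem_diffPlane, hw w i hi, hw w j hj, ← sub_eq_zero, ← sub_mul, ← sub_mul]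
      · refine ⟨coordPlane ⟨j, hj⟩ (c i - k), Or.inr (Or.inr ⟨⟨j, hj⟩, _, (hN _ _).2 (Or.inr
          ⟨i, hi, ?_⟩), rfl⟩), ?_⟩
        · rw [Finset.mem_Icc]; omega
        · ext w
          simp only [Submodule.mem_comap, Submodule.subtype_apply, LinearEquiv.coe_coe,
            mem_diffPlane, mem_coordPlane, hw w i hi, hf1, hf2]
          push_cast
          constructor <;> intro h <;> linarith
      · refine ⟨coordPlane ⟨i, hi⟩ (c j + k), Or.inr (Or.inr ⟨⟨i, hi⟩, _, (hN _ _).2 (Or.inr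
          ⟨j, hj, ?_⟩), rfl⟩), ?_⟩
        · rw [Finset.mem_Icc]; omega
        · ext w
          simp only [Submodule.mem_comap, Submodule.subtype_apply, LinearEquiv.coe_coe,
            mem_diffPlane, mem_coordPlane, hw w j hj, hf1, hf2]
          push_cast
          constructor <;> intro h <;> linarith
      · exact ⟨diffPlane ⟨i, hi⟩ ⟨j, hj⟩ k, Or.inr (Or.inl ⟨_, _, fun h => hij (congrArg (·.1) h),
          k, Finset.mem_Icc.2 hk, rfl⟩), rfl⟩
    · by_cases hi : S i
      · refine ⟨_, Or.inl rfl, (hinf _ ((c i : ℝ) - k) hle fun w => ?_).symm⟩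
        rw [mem_coordPlane, hw w i hi, ← sub_eq_zero, ← sub_mul]
      · exact ⟨coordPlane ⟨i, hi⟩ k, Or.inr (Or.inr ⟨_, k, (hN _ _).2 (Or.inl hk), rfl⟩), rfl⟩
  · rintro ⟨L', hL', rfl⟩
    suffices h : ∃ L ∈ (weightArr ι a N).planes,
        L'.comap f.toLinearMap = L.comap (fixSpace S c).subtype by
      obtain ⟨L, hL, hLL⟩ := h
      refine ⟨L, hL, fun hle => ?_, hLL⟩
      rw [Submodule.comap_subtype_eq_top.2 hle] at hLL
      obtain ⟨α, hα, rfl⟩ := (weightArr _ a N').hyperplane L' hL'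
      refine hα (LinearMap.ext fun v => ?_)
      obtain ⟨w, rfl⟩ := f.surjective v
      have : w ∈ (LinearMap.ker α).comap f.toLinearMap := hLL ▸ Submodule.mem_top
      exact this
    obtain rfl | ⟨i, j, hij, k, hk, rfl⟩ | ⟨i, k, hk, rfl⟩ := mem_weightArr.1 hL'
    · exact ⟨_, Or.inl rfl, rfl⟩
    · exact ⟨_, Or.inr (Or.inl ⟨i, j, fun h => hij (Subtype.ext h), k, hk, rfl⟩), rfl⟩
    · rcases (hN _ _).1 hk with hk | ⟨j, hj, hk⟩
      · exact ⟨_, Or.inr (Or.inr ⟨i, k, hk, rfl⟩), rfl⟩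
      · refine ⟨_, Or.inr (Or.inl ⟨i, j, fun h => i.2 (h ▸ hj), _, hk, rfl⟩), ?_⟩
        ext w
        simp only [Submodule.mem_comap, Submodule.subtype_apply, LinearEquiv.coe_coe,
          mem_diffPlane, mem_coordPlane, hw w j hj, hf1, hf2]
        push_cast
        constructor <;> intro h <;> linarith

/-- The translation `x_i ↦ x_i + t z`. -/
def translate (ι : Type) (t : ℤ) : ((ι → ℝ) × ℝ) ≃ₗ[ℝ] ((ι → ℝ) × ℝ) where
  toFun w := (fun i => w.1 i + t * w.2, w.2)
  map_add' v w := by ext <;> simp; ring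
  map_smul' r w := by ext <;> simp; ring
  invFun w := (fun i => w.1 i - t * w.2, w.2)
  left_inv w := by ext <;> simp
  right_inv w := by ext <;> simp

theorem weightArr_translate [Finite ι] (a : ℕ) {N N' : ι → Finset ℤ} (t : ℤ)
    (hN : ∀ i k, k ∈ N' i ↔ k + t ∈ N i) :
    weightArr ι a N' = (weightArr ι a N).comap (translate ι t).toLinearMap
      (translate ι t).surjective := by
  have h1 : (planeAtInfinity (ι → ℝ)).comap (translate ι t).toLinearMap =
      planeAtInfinity (ι → ℝ) := rfl
  have h2 : ∀ i j k, (diffPlane (ι := ι) i j k).comap (translate ι t).toLinearMap =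
      diffPlane i j k := by
    intro i j k
    ext w
    simp [mem_diffPlane, translate]
  have h3 : ∀ i k, (coordPlane (ι := ι) i (k + t)).comap (translate ι t).toLinearMap =
      coordPlane i k := by
    intro i k
    ext w
    simp [mem_coordPlane, translate, add_mul]
  ext K
  constructor
  · rintro (rfl | ⟨i, j, hij, k, hk, rfl⟩ | ⟨i, k, hk, rfl⟩)
    · exact ⟨_, Or.inl rfl, h1⟩
    · exact ⟨_, Or.inr (Or.inl ⟨i, j, hij, k, hk, rfl⟩), h2 i j k⟩
    · exact ⟨_, Or.inr (Or.inr ⟨i, _, (hN i k).1 hk, rfl⟩), h3 i k⟩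
  · rintro ⟨_, rfl | ⟨i, j, hij, k, hk, rfl⟩ | ⟨i, k, hk, rfl⟩, rfl⟩
    · exact Or.inl h1
    · exact Or.inr (Or.inl ⟨i, j, hij, k, hk, h2 i j k⟩)
    · refine Or.inr (Or.inr ⟨i, k - t, (hN i _).2 (by simpa using hk), ?_⟩)
      conv_lhs => rw [← sub_add_cancel k t]
      exact h3 _ _

theorem diffPlane_comm (i j : ι) (k : ℤ) : diffPlane i j k = diffPlane j i (-k) := by
  ext w
  simp only [mem_diffPlane]
  push_cast
  constructor <;> intro h <;> linarith

/-- The differences `x_i - x_p`, `i ≠ p`. -/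
def diffMap (p : ι) : ((ι → ℝ) × ℝ) →ₗ[ℝ] (({i // ¬ i = p} → ℝ) × ℝ) where
  toFun w := (fun i => w.1 i - w.1 p, w.2)
  map_add' v w := by ext <;> simp; ring
  map_smul' r w := by ext <;> simp; ring

open Classical in
theorem diffMap_surjective (p : ι) : Function.Surjective (diffMap p) := by
  intro y
  refine ⟨(fun i => if h : i = p then 0 else y.1 ⟨i, h⟩, y.2), ?_⟩
  refine Prod.ext (funext fun i => ?_) rfl
  simp [diffMap, i.2]

/-- Without coordinate planes only differences occur. Taking x_p as origin, the planes x_i - x_p =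
kz become coordinate planes with weights [-a, a]. -/
theorem weightArr_diffMap [Finite ι] (a : ℕ) (p : ι) :
    weightArr ι a (fun _ => ∅) = (weightArr {i // ¬ i = p} a
      fun _ => Finset.Icc (-(a : ℤ)) a).comap (diffMap p) (diffMap_surjective p) := by
  have h1 : (planeAtInfinity ({i // ¬ i = p} → ℝ)).comap (diffMap p) =
      planeAtInfinity (ι → ℝ) := rfl
  have h2 : ∀ i j k, (diffPlane (ι := {i // ¬ i = p}) i j k).comap (diffMap p) =
      diffPlane i.1 j.1 k := by
    intro i j k
    ext w
    simp [mem_diffPlane, diffMap]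
  have h3 : ∀ (i : {i // ¬ i = p}) k, (coordPlane i k).comap (diffMap p) = diffPlane i.1 p k :=
    fun i k => rfl
  ext K
  constructor
  · rintro (rfl | ⟨i, j, hij, k, hk, rfl⟩ | ⟨i, k, hk, rfl⟩)
    · exact ⟨_, Or.inl rfl, h1⟩
    · by_cases hi : i = p
      · subst hi
        rw [diffPlane_comm]
        exact ⟨_, Or.inr (Or.inr ⟨⟨j, hij.symm⟩, -k, by
          rw [Finset.mem_Icc] at hk ⊢; omega, rfl⟩), h3 _ _⟩
      · by_cases hj : j = p
        · subst hj
          exact ⟨_, Or.inr (Or.inr ⟨⟨i, hij⟩, k, hk, rfl⟩), h3 _ _⟩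
        · exact ⟨_, Or.inr (Or.inl ⟨⟨i, hi⟩, ⟨j, hj⟩, fun h => hij (congrArg (·.1) h), k, hk, rfl⟩),
            h2 _ _ _⟩
    · simp at hk
  · rintro ⟨_, rfl | ⟨i, j, hij, k, hk, rfl⟩ | ⟨i, k, hk, rfl⟩, rfl⟩
    · exact Or.inl h1
    · exact Or.inr (Or.inl ⟨i, j, fun h => hij (Subtype.ext h), k, hk, h2 i j k⟩)
    · exact Or.inr (Or.inl ⟨i, p, i.2, k, hk, h3 i k⟩)

end Planes

/-! ### Inductive freeness for interval weights. -/

theorem map_range_succ_eq_cons (f : ℕ → ℕ) (n : ℕ) :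
    (Multiset.range (n + 1)).map f = f 0 ::ₘ (Multiset.range n).map fun i => f (i + 1) := by
  rw [← Multiset.coe_range, ← Multiset.coe_range, List.range_succ_eq_map]
  simp [Function.comp_def]

theorem map_range_congr {f g : ℕ → ℕ} {n : ℕ} (h : ∀ i < n, f i = g i) :
    (Multiset.range n).map f = (Multiset.range n).map g :=
  Multiset.map_congr rfl fun i hi => h i (Multiset.mem_range.1 hi)

theorem indFree_weightArr_of_isEmpty {ι : Type} [Fintype ι] [IsEmpty ι] (a : ℕ)
    (N : ι → Finset ℤ) : IndFree (weightArr ι a N) {1} := by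
  have hp : (weightArr ι a N).planes = {planeAtInfinity (ι → ℝ)} := by
    ext K
    rw [mem_weightArr, Set.mem_singleton_iff]
    constructor
    · rintro (h | ⟨i, -⟩ | ⟨i, -⟩)
      · exact h
      · exact isEmptyElim i
      · exact isEmptyElim i
    · exact Or.inl
  have hinf : planeAtInfinity (ι → ℝ) = ⊥ := by
    refine (Submodule.eq_bot_iff _).2 fun w hw => ?_
    rw [mem_planeAtInfinity] at hw
    exact Prod.ext (Subsingleton.elim _ _) hw
  have h0 : IndFree ((weightArr ι a N).deletion (planeAtInfinity (ι → ℝ))) {0} := by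
    have := IndFree.empty ((weightArr ι a N).deletion (planeAtInfinity (ι → ℝ)))
      (by simp [CentralArr.deletion, hp])
    simpa using this
  have h1 : IndFree ((weightArr ι a N).restriction (planeAtInfinity (ι → ℝ))) 0 := by
    have := IndFree.empty ((weightArr ι a N).restriction (planeAtInfinity (ι → ℝ))) (by
      refine Set.eq_empty_of_forall_notMem ?_
      rintro K ⟨L, hL, hle, -⟩
      rw [hp] at hL
      exact hle (Set.mem_singleton_iff.1 hL).ge)
    rw [hinf, finrank_bot] at this
    rw [hinf]
    exact this
  exact .addition _ _ (by simp [hp]) 0 0 h0 h1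

/-- Adding the hyperplane `x_p = k z`. -/
theorem indFree_weightArr_add {ι : Type} [Fintype ι] {a : ℕ} {N N₀ : ι → Finset ℤ} (p : ι) (k : ℤ)
    (hN : ∀ i l, l ∈ N i ↔ l ∈ N₀ i ∨ (i = p ∧ l = k)) (hk : k ∉ N₀ p)
    {N' : {i // ¬ i = p} → Finset ℤ}
    (hN' : ∀ j l, l ∈ N' j ↔ l ∈ N₀ j ∨ l - k ∈ Finset.Icc (-(a : ℤ)) a) {x : ℕ} {e : Multiset ℕ}
    (h₀ : IndFree (weightArr ι a N₀) (x ::ₘ e)) (h' : IndFree (weightArr _ a N') e) :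
    IndFree (weightArr ι a N) ((x + 1) ::ₘ e) := by
  have hfix : fixSpace (fun i => i = p) (fun _ => k) = coordPlane p k := by
    ext w
    simp [mem_fixSpace, mem_coordPlane]
  refine .addition (weightArr ι a N) (coordPlane p k)
    (Or.inr (Or.inr ⟨p, k, (hN p k).2 (Or.inr ⟨rfl, rfl⟩), rfl⟩))
    x e ?_ ?_
  · rw [weightArr_deletion (N' := N₀)]
    · exact h₀
    · intro i l
      rw [hN]
      constructor
      · intro h
        refine ⟨Or.inl h, ?_⟩
        rintro ⟨rfl, rfl⟩
        exact hk h
      · rintro ⟨h | h, h'⟩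
        · exact h
        · exact absurd h h'
  · rw [← hfix, weightArr_restriction_fixSpace (N' := N') a (fun i => i = p) (fun _ => k)]
    · exact h'.comapEquiv _
    · intro j l
      rw [hN', hN]
      have := j.2
      simp [this]

/-- The weights `[1, w + 1]` on `Q` and `[1, w]` elsewhere. -/
def stepWeight {ι : Type} [DecidableEq ι] (w : ℕ) (Q : Finset ι) (i : ι) : Finset ℤ :=
  Finset.Icc 1 (if i ∈ Q then (w : ℤ) + 1 else w)

theorem mem_stepWeight {ι : Type} [DecidableEq ι] {w : ℕ} {Q : Finset ι} {i : ι} {k : ℤ} :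
    k ∈ stepWeight w Q i ↔ 1 ≤ k ∧ (k ≤ w ∨ i ∈ Q ∧ k ≤ w + 1) := by
  rw [stepWeight, Finset.mem_Icc]
  split_ifs with h
  · simp only [h, true_and]; omega
  · simp [h]

/-- The exponent that changes while the weights `[1, w]` are enlarged. -/
def movingExp (a L w q : ℕ) : ℕ := if a ≤ w then w + a * L + q else (L + 1) * w + q

/-- The inductive freeness statement for full intervals as weights. -/
def FullStatement (a L : ℕ) : Prop :=
  ∀ (ι : Type) [Fintype ι], Fintype.card ι = L → ∀ (lo : ℤ) (W : ℕ), a ≤ W →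
    IndFree (weightArr ι a fun _ => Finset.Icc lo (lo + W - 1))
      (1 ::ₘ (Multiset.range L).map fun i => i + W + a * (L - 1))

/-- Start of the inner induction: the case of L coordinates with interval length 2a + 1, pulled back
along differences. The exponent 0 comes from the one-dimensional kernel. -/
theorem indFree_weightArr_empty {a L : ℕ} (hL : FullStatement a L) (ι : Type) [Fintype ι]
    (hι : Fintype.card ι = L + 1) : IndFree (weightArr ι a fun _ => ∅)
      (0 ::ₘ 1 ::ₘ (Multiset.range L).map fun i => i + 1 + a + a * L) := by
  classical
  obtain ⟨p⟩ : Nonempty ι := Fintype.card_pos_iff.1 (by omega)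
  have hcard : Fintype.card {i // ¬ i = p} = L := by
    rw [Fintype.card_subtype_compl, Fintype.card_subtype_eq, hι, Nat.add_sub_cancel]
  have h := (hL {i // ¬ i = p} hcard (-(a : ℤ)) (2 * a + 1) (by omega)).comap (diffMap p)
    (diffMap_surjective p) (k := 1) (by simp [Module.finrank_prod, hι, hcard])
  have hW : (-(a : ℤ) + (2 * a + 1 : ℕ) - 1) = a := by push_cast; ring
  rw [hW, ← weightArr_diffMap] at h
  have he : (1 ::ₘ (Multiset.range L).map fun i => i + (2 * a + 1) + a * (L - 1)) +
      Multiset.replicate 1 0 =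
      0 ::ₘ 1 ::ₘ (Multiset.range L).map fun i => i + 1 + a + a * L := by
    rw [Multiset.replicate_one, Multiset.add_comm, Multiset.singleton_add]
    congr 2
    refine map_range_congr fun i hi => ?_
    obtain ⟨L, rfl⟩ : ∃ M, L = M + 1 := ⟨L - 1, by omega⟩
    rw [Nat.add_sub_cancel]
    ring
  rwa [he] at h

/-- Induction on w and, inside a round, on Q. Each addition changes only the moving exponent. Below
w = a the common exponents stay put; from there on, completing a round shifts the whole run of
exponents by one. -/
theorem indFree_stepWeight {a L : ℕ} (hL : FullStatement a L) (ι : Type) [Fintype ι]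
    [DecidableEq ι] (hι : Fintype.card ι = L + 1) (w : ℕ) (Q : Finset ι) :
    IndFree (weightArr ι a (stepWeight w Q))
      (movingExp a L w Q.card ::ₘ 1 ::ₘ
        (Multiset.range L).map fun i => i + 1 + max w a + a * L) := by
  have hbase : ∀ w, IndFree (weightArr ι a (stepWeight w ∅))
      (movingExp a L w 0 ::ₘ 1 ::ₘ (Multiset.range L).map fun i => i + 1 + max w a + a * L) →
      ∀ Q : Finset ι, IndFree (weightArr ι a (stepWeight w Q))
        (movingExp a L w Q.card ::ₘ 1 ::ₘ
          (Multiset.range L).map fun i => i + 1 + max w a + a * L) := by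
    intro w hw Q
    induction Q using Finset.induction_on with
    | empty => exact hw
    | insert p Q hp ih =>
      have hcard : Fintype.card {i // ¬ i = p} = L := by
        rw [Fintype.card_subtype_compl, Fintype.card_subtype_eq, hι, Nat.add_sub_cancel]
      have hm : movingExp a L w (insert p Q).card = movingExp a L w Q.card + 1 := by
        rw [Finset.card_insert_of_notMem hp, movingExp, movingExp]
        split_ifs <;> ring
      rw [hm]
      -- On x_p = (w+1)z both [1, w] and [1, w+1] unite with [w+1-a, w+1+a] to the same interval,
      -- from min(1, w+1-a) to w+1+a. Membership in Q is thus forgotten.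
      have h' := hL {i // ¬ i = p} hcard (min 1 (w + 1 - a : ℤ)) (max w a + a + 1) (by omega)
      have he : (1 ::ₘ (Multiset.range L).map fun i => i + (max w a + a + 1) + a * (L - 1)) =
          1 ::ₘ (Multiset.range L).map fun i => i + 1 + max w a + a * L := by
        congr 1
        refine map_range_congr fun i hi => ?_
        obtain ⟨L, rfl⟩ : ∃ M, L = M + 1 := ⟨L - 1, by omega⟩
        rw [Nat.add_sub_cancel]
        ring
      rw [he] at h'
      refine indFree_weightArr_add p (w + 1) ?_ ?_ ?_ ih h'
      · intro i l
        rw [mem_stepWeight, mem_stepWeight, Finset.mem_insert]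
        by_cases hi : i = p
        · subst hi
          simp only [hp, true_and, false_and, or_false]
          omega
        · simp [hi]
      · rw [mem_stepWeight]
        simp [hp]
      · intro j l
        rw [mem_stepWeight, Finset.mem_Icc, Finset.mem_Icc]
        push_cast
        by_cases hj : (j : ι) ∈ Q <;> simp only [hj, true_and, false_and, or_false] <;> omega
  refine hbase w ?_ Q
  clear Q
  induction w with
  | zero =>
    have h := indFree_weightArr_empty hL ι hι
    have h1 : (fun _ : ι => (∅ : Finset ℤ)) = stepWeight 0 ∅ := by
      funext i
      simp [stepWeight]
    rw [h1] at h
    convert h using 2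
    · rw [movingExp]
      split_ifs with h0
      · obtain rfl : a = 0 := by omega
        simp
      · simp
    · simp
  | succ w ih =>
    have h := hbase w ih Finset.univ
    have h1 : stepWeight w (Finset.univ : Finset ι) = stepWeight (w + 1) ∅ := by
      funext i
      simp [stepWeight]
    rw [h1, Finset.card_univ, hι] at h
    convert h using 1
    by_cases hw : a ≤ w
    · rw [movingExp, movingExp, if_pos (by omega), if_pos hw, max_eq_left (by omega),
        max_eq_left hw, Multiset.cons_swap, Multiset.cons_swap _ 1]
      congr 1
      -- After a full round the moving exponent is the top of a run of L + 1 consecutive integers.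
      -- In the next round the bottom of that run is the moving one.
      have e1 := map_range_succ_eq_cons (fun i => i + 1 + w + a * L) L
      rw [Multiset.range_succ, Multiset.map_cons] at e1
      convert e1.symm using 2
      · ring
      · exact map_range_congr fun i _ => by ring
      · ring
    · rw [max_eq_right (by omega), max_eq_right (by omega)]
      congr 1
      -- Below a the moving exponent gains L + 1 per round; at w + 1 = a the two formulas agree.
      rw [movingExp, movingExp, if_neg hw]
      split_ifs with hw'
      · obtain rfl : a = w + 1 := by omega
        ring
      · ring

/-- The outer induction on the number of coordinates; a translation in the direction of z moves the
lower end of the interval to 1. -/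
theorem fullStatement (a L : ℕ) : FullStatement a L := by
  induction L with
  | zero =>
    intro ι _ hι lo W _
    have := Fintype.card_eq_zero_iff.1 hι
    simpa using indFree_weightArr_of_isEmpty a fun _ : ι => Finset.Icc lo (lo + W - 1)
  | succ L ih =>
    intro ι _ hι lo W hW
    classical
    have h := indFree_stepWeight ih ι hι W ∅
    have ht := h.comapEquiv (translate ι (1 - lo))
    rw [← weightArr_translate (N' := fun _ => Finset.Icc lo (lo + W - 1))] at ht
    · convert ht using 1
      rw [Multiset.cons_swap, map_range_succ_eq_cons, movingExp, if_pos hW, max_eq_left hW]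
      congr 2
      simp
    · intro i k
      rw [mem_stepWeight, Finset.mem_Icc]
      simp only [Finset.notMem_empty, false_and, or_false]
      omega

/-- The inductive freeness of the arrangement with the planes `z = 0`, `x_i - x_j = k z` for
`-a ≤ k ≤ a`, and `x_i = k z` for `k` in one of two neighbouring intervals. -/
theorem indFree_weightArr {a L : ℕ} (ι : Type) [Fintype ι] [DecidableEq ι]
    (hι : Fintype.card ι = L + 1) (lo : ℤ) (w : ℕ) (hw : a ≤ w) (Q : Finset ι) {N : ι → Finset ℤ}
    (hN : ∀ i, N i = Finset.Icc lo (if i ∈ Q then lo + w else lo + w - 1)) :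
    IndFree (weightArr ι a N) (1 ::ₘ (w + a * L + Q.card) ::ₘ
      (Multiset.range L).map fun i => i + 1 + w + a * L) := by
  have h := indFree_stepWeight (fullStatement a L) ι hι w Q
  have ht := h.comapEquiv (translate ι (1 - lo))
  rw [← weightArr_translate (N' := N)] at ht
  · rw [Multiset.cons_swap]
    rwa [movingExp, if_pos hw, max_eq_left hw] at ht
  · intro i k
    rw [mem_stepWeight, hN, Finset.mem_Icc]
    by_cases hi : i ∈ Q <;> simp only [hi, true_and, false_and, or_false, if_true, if_false] <;>
      omega

/-! ### Flags with inductively free restrictions. -/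

/-- A flag of flats on which an arrangement restricts to inductively free arrangements with the
initial segments of `e` as exponents. -/
structure IsIndFreeFlag {V : Type u} [AddCommGroup V] [Module ℝ V] (A : CentralArr V)
    (X : ℕ → Submodule ℝ V) (e : List ℕ) : Prop where
  sorted : e.Pairwise (· ≤ ·)
  indFree : IndFree A (e : Multiset ℕ)
  mono : ∀ d, 1 ≤ d → d < Module.finrank ℝ V → X d ≤ X (d + 1)
  isFlat : ∀ d, 1 ≤ d → d ≤ Module.finrank ℝ V → A.IsFlat (X d)
  finrank_eq : ∀ d, 1 ≤ d → d ≤ Module.finrank ℝ V → Module.finrank ℝ (X d) = d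
  restriction : ∀ d, 1 ≤ d → d ≤ Module.finrank ℝ V →
    IndFree (A.restriction (X d)) (e.take d : Multiset ℕ)

namespace IsIndFreeFlag

variable {V W : Type u} [AddCommGroup V] [Module ℝ V] [AddCommGroup W] [Module ℝ W]
  {A : CentralArr V} {X : ℕ → Submodule ℝ V} {e : List ℕ}

theorem isIndFlagAccuracyWitness (h : IsIndFreeFlag A X e) : A.IsIndFlagAccuracyWitness X :=
  ⟨h.indFree.isInductivelyFree,
    ⟨⟨e, h.sorted, h.indFree.hasExponents, fun d h1 h2 =>
      ⟨h.isFlat d h1 h2, h.finrank_eq d h1 h2, (h.restriction d h1 h2).hasExponents⟩⟩, h.mono⟩,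
    fun d h1 h2 => (h.restriction d h1 h2).isInductivelyFree⟩

theorem comapEquiv (h : IsIndFreeFlag A X e) (f : W ≃ₗ[ℝ] V) :
    IsIndFreeFlag (A.comap f.toLinearMap f.surjective)
      (fun d => (X d).comap f.toLinearMap) e := by
  have hdim := f.finrank_eq
  have hX : ∀ d, Function.Bijective (CentralArr.comapMap f.toLinearMap (X d)) := fun d =>
    ⟨fun v w hvw => Subtype.ext (f.injective (congrArg Subtype.val hvw)),
      CentralArr.comapMap_surjective f.surjective _⟩
  refine ⟨h.sorted, h.indFree.comapEquiv f, fun d h1 h2 => Submodule.comap_mono (h.mono d h1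
    (hdim ▸ h2)), fun d h1 h2 => ?_, fun d h1 h2 => ?_, fun d h1 h2 => ?_⟩
  · obtain ⟨B, hB, hXB⟩ := h.isFlat d h1 (hdim ▸ h2)
    refine ⟨Submodule.comap f.toLinearMap '' B, Set.image_mono hB, ?_⟩
    rw [hXB]
    ext w
    simp [Submodule.mem_sInf]
  · rw [(LinearEquiv.ofBijective _ (hX d)).finrank_eq, h.finrank_eq d h1 (hdim ▸ h2)]
  · rw [CentralArr.comap_restriction]
    exact (h.restriction d h1 (hdim ▸ h2)).comapEquiv (LinearEquiv.ofBijective _ (hX d))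

end IsIndFreeFlag

/-! ### The arrangements E and their flag. -/

/-- The weights of the arrangement `E^p_ℓ(n, a, m)`. -/
def weightE (p ℓ n a m : ℕ) (i : Fin ℓ) : Finset ℤ :=
  if (i : ℕ) < p then Finset.Icc (-((n : ℤ) * (a : ℤ))) (m : ℤ)
  else Finset.Icc (-((n : ℤ) * (a : ℤ))) ((m : ℤ) + 1)

theorem mem_weightE {p ℓ n a m : ℕ} {i : Fin ℓ} {k : ℤ} :
    k ∈ weightE p ℓ n a m i ↔
      -((n : ℤ) * a) ≤ k ∧ (k ≤ m ∨ ¬ (i : ℕ) < p ∧ k ≤ m + 1) := by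
  rw [weightE]
  split_ifs with h <;> rw [Finset.mem_Icc]
  · simp [h]
  · simp only [h, not_false_eq_true, true_and]
    omega

theorem homogenize_congr {V : Type u} [AddCommGroup V] [Module ℝ V] {α β : Module.Dual ℝ V}
    {c d : ℝ} (hα : α ≠ 0) (hβ : β ≠ 0) (h : {v | α v = c} = {v | β v = d}) :
    homogenize α c = homogenize β d :=
  le_antisymm (homogenize_le hα h) (homogenize_le hβ h.symm)

theorem cone_arrE (p ℓ n a m : ℕ) :
    (arrE p ℓ n a m).cone = weightArr (Fin ℓ) a (weightE p ℓ n a m) := by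
  ext K
  constructor
  · rintro (rfl | ⟨α, c, hα, ⟨i, j, hij, k, hk, hH⟩ | ⟨i, k, hk, hH⟩, rfl⟩)
    · exact Or.inl rfl
    · rw [homogenize_congr hα (coord_sub_coord_ne_zero ℓ hij) hH]
      dsimp only at hk
      split_ifs at hk
      · exact Or.inr (Or.inl ⟨i, j, hij, k, hk, rfl⟩)
      · simp at hk
    · rw [homogenize_congr hα (coord_ne_zero ℓ i) hH]
      exact Or.inr (Or.inr ⟨i, k, hk, rfl⟩)
  · have hd : ∀ i j : Fin ℓ, i < j → ∀ k ∈ Finset.Icc (-(a : ℤ)) a,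
        diffPlane i j k ∈ (arrE p ℓ n a m).cone.planes := fun i j hij k hk =>
      Or.inr ⟨_, _, coord_sub_coord_ne_zero ℓ hij.ne, Or.inl ⟨i, j, hij.ne, k,
        by simpa [hij] using hk, rfl⟩, rfl⟩
    rintro (rfl | ⟨i, j, hij, k, hk, rfl⟩ | ⟨i, k, hk, rfl⟩)
    · exact Or.inl rfl
    · rcases lt_or_gt_of_ne hij with h | h
      · exact hd i j h k hk
      · rw [diffPlane_comm]
        exact hd j i h _ (by rw [Finset.mem_Icc] at hk ⊢; omega)
    · exact Or.inr ⟨_, _, coord_ne_zero ℓ i, Or.inr ⟨i, k, hk, rfl⟩, rfl⟩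

/-- The exponents of `c E^p_ℓ(n, a, m)`, `s = m + a (ℓ + n - 1)`, in increasing order. -/
def sortedExps (p ℓ s : ℕ) : List ℕ :=
  1 :: (List.range ℓ).map fun i => (if i < ℓ - p then i + 2 else i + 1) + s

theorem sortedExps_pairwise (p ℓ s : ℕ) :
    (sortedExps p ℓ s).Pairwise (· ≤ ·) := by
  refine List.pairwise_cons.2 ⟨fun x hx => ?_, ?_⟩
  · obtain ⟨i, -, rfl⟩ := List.mem_map.1 hx
    split_ifs <;> omega
  · refine List.pairwise_map.2 (List.pairwise_lt_range.imp fun {i j} hij => ?_)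
    split_ifs <;> omega

/-- The sorted list runs through consecutive integers with one value repeated or, at an end,
adjoined. An initial segment is again of this form, with its special value capped by its length. -/
theorem map_range_bump (q L s : ℕ) :
    (Multiset.range (L + 1)).map (fun i => (if i < q then i + 2 else i + 1) + s) =
      (min q (L + 1) + 1 + s) ::ₘ (Multiset.range L).map fun i => i + 2 + s := by
  induction L with
  | zero =>
    rcases Nat.eq_zero_or_pos q with rfl | hq
    · simp
    · simp [hq, Nat.min_eq_right hq]
  | succ L ih =>
    rw [Multiset.range_succ, Multiset.map_cons, ih, Multiset.range_succ, Multiset.map_cons]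
    by_cases hq : L + 1 < q
    · rw [if_pos hq, min_eq_right (by omega), min_eq_right (by omega)]
    · rw [if_neg hq, min_eq_left (by omega), min_eq_left (by omega), Multiset.cons_swap]

theorem coe_take_sortedExps {p ℓ s r : ℕ} (hr : r ≤ ℓ) :
    ((sortedExps p ℓ s).take (r + 1) : Multiset ℕ) =
      1 ::ₘ (Multiset.range r).map fun i => (if i < ℓ - p then i + 2 else i + 1) + s := by
  rw [sortedExps, List.take_succ_cons, ← List.map_take, List.take_range, min_eq_left hr]
  rfl

theorem coe_sortedExps (p ℓ s : ℕ) : (sortedExps p (ℓ + 1) s : Multiset ℕ) =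
    shiftedExps p (ℓ + 1) s := by
  have h := coe_take_sortedExps (p := p) (s := s) (le_refl (ℓ + 1))
  rw [List.take_of_length_le (by simp [sortedExps]), map_range_bump,
    min_eq_left (Nat.sub_le _ _)] at h
  rw [h, shiftedExps, Multiset.map_cons]
  have : (Finset.Icc 2 (ℓ + 1)).val = (Multiset.range ℓ).map fun i => i + 2 := by
    change ((List.range' 2 ℓ : List ℕ) : Multiset ℕ) = _
    rw [List.range'_eq_map_range]
    simp [← Multiset.coe_range, add_comm]
  rw [this, Multiset.map_map]
  rfl

theorem card_filter_not_lt (ℓ p : ℕ) :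
    (Finset.univ.filter fun j : Fin ℓ => ¬ (j : ℕ) < p).card = ℓ - p := by
  rw [← Nat.card_Ico, ← Finset.card_image_of_injective _ Fin.val_injective]
  congr 1
  ext k
  simp only [Finset.mem_image, Finset.mem_filter, Finset.mem_univ, true_and, Finset.mem_Ico]
  constructor
  · rintro ⟨j, hj, rfl⟩
    have := j.isLt
    omega
  · rintro ⟨h1, h2⟩
    exact ⟨⟨k, h2⟩, by simp only; omega, rfl⟩

theorem card_filter_tail (ℓ t p : ℕ) :
    (Finset.univ.filter fun j : {i : Fin ℓ // ¬ (i : ℕ) < t} => ¬ (j.1 : ℕ) < p).card =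
      ℓ - max p t := by
  have hinj : Function.Injective fun j : {i : Fin ℓ // ¬ (i : ℕ) < t} => (j.1 : ℕ) :=
    fun i j h => Subtype.ext (Fin.ext h)
  rw [← Nat.card_Ico, ← Finset.card_image_of_injective _ hinj]
  congr 1
  ext k
  simp only [Finset.mem_image, Finset.mem_filter, Finset.mem_univ, true_and, Finset.mem_Ico]
  constructor
  · rintro ⟨j, hj, rfl⟩
    have := j.2
    have := j.1.isLt
    omega
  · rintro ⟨h1, h2⟩
    exact ⟨⟨⟨k, h2⟩, by simp only; omega⟩, by simp only; omega, rfl⟩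

theorem card_tail (ℓ t : ℕ) : Fintype.card {i : Fin ℓ // ¬ (i : ℕ) < t} = ℓ - t := by
  have := card_filter_tail ℓ t 0
  simpa using this

/-- The subspace `x_1 = -n a z, x_2 = -(n + 1) a z, …` with `ℓ + 1 - d` equations. -/
def arrEFlag (ℓ n a d : ℕ) : Submodule ℝ ((Fin ℓ → ℝ) × ℝ) :=
  fixSpace (fun i => (i : ℕ) < ℓ + 1 - d) fun i => -(((n : ℤ) + (i : ℕ)) * a)

/-- The hyperplanes `x_1 = -n a z` and `x_(i-1) - x_i = a z`. -/
def arrEFlagPlane (ℓ n a : ℕ) (i : Fin ℓ) : Submodule ℝ ((Fin ℓ → ℝ) × ℝ) :=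
  if (i : ℕ) = 0 then coordPlane i (-((n : ℤ) * a))
  else diffPlane ⟨(i : ℕ) - 1, lt_of_le_of_lt (Nat.sub_le _ _) i.isLt⟩ i a

/-- The differences telescope. The right-hand side exhibits the subspace as an intersection of
planes of the arrangement. -/
theorem arrEFlag_eq_iInf (ℓ n a d : ℕ) :
    arrEFlag ℓ n a d = ⨅ i : Fin ℓ, ⨅ _ : (i : ℕ) < ℓ + 1 - d, arrEFlagPlane ℓ n a i := by
  ext w
  simp only [arrEFlag, mem_fixSpace, Submodule.mem_iInf]
  constructor
  · intro h i hi
    rw [arrEFlagPlane]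
    split_ifs with h0
    · rw [mem_coordPlane, h i hi, h0]
      simp
    · rw [mem_diffPlane, h i hi, h ⟨i - 1, _⟩ (by simp only; omega)]
      obtain ⟨k, hk⟩ := Nat.exists_eq_succ_of_ne_zero h0
      simp only [hk, Nat.succ_sub_one]
      push_cast
      ring
  · rintro h ⟨i, hiℓ⟩
    induction i with
    | zero =>
      intro hi
      have := h _ hi
      rw [arrEFlagPlane, if_pos rfl, mem_coordPlane] at this
      simpa using this
    | succ i ih =>
      intro hi
      have h1 := ih (by omega) (by simp only at hi ⊢; omega)
      have h2 := h _ hi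
      rw [arrEFlagPlane, if_neg (Nat.succ_ne_zero i), mem_diffPlane] at h2
      simp only [Nat.add_sub_cancel] at h1 h2
      rw [← sub_sub_self (w.1 ⟨i, by omega⟩) (w.1 ⟨i + 1, hiℓ⟩), h2, h1]
      push_cast
      ring

theorem arrEFlagPlane_mem {p ℓ n a m : ℕ} (i : Fin ℓ) :
    arrEFlagPlane ℓ n a i ∈ (weightArr (Fin ℓ) a (weightE p ℓ n a m)).planes := by
  rw [arrEFlagPlane]
  split_ifs with h0
  · refine Or.inr (Or.inr ⟨i, _, mem_weightE.2 ⟨le_rfl, Or.inl ?_⟩, rfl⟩)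
    have : (0 : ℤ) ≤ (n : ℤ) * a := by positivity
    omega
  · refine Or.inr (Or.inl ⟨_, i, fun h => ?_, a, Finset.mem_Icc.2 ⟨by omega, le_rfl⟩, rfl⟩)
    have := congrArg Fin.val h
    simp only at this
    omega

theorem finrank_arrEFlag (ℓ n a d : ℕ) (h1 : 1 ≤ d) (h2 : d ≤ ℓ + 1) :
    Module.finrank ℝ (arrEFlag ℓ n a d) = d := by
  rw [arrEFlag, (fixSpaceEquiv _ _).finrank_eq, Module.finrank_prod, Module.finrank_pi,
    Module.finrank_self, card_tail]
  omega

/-- With t = ℓ - r coordinates fixed, the overlapping intervals -(n+i)a + [-a, a], i < t, extend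
each remaining weight down to -(n+t)a and leave its upper end alone. The number of long weights is
then min(ℓ-p, r), as the sorted exponents demand. -/
theorem indFree_restriction_arrEFlag {p ℓ n a m r : ℕ} (hn : 1 ≤ n) (hr : r ≤ ℓ) (hp : p ≤ ℓ) :
    IndFree ((weightArr (Fin ℓ) a (weightE p ℓ n a m)).restriction (arrEFlag ℓ n a (r + 1)))
      ((sortedExps p ℓ (m + a * (ℓ + n - 1))).take (r + 1) : Multiset ℕ) := by
  obtain ⟨t, rfl⟩ := Nat.exists_eq_add_of_le hr
  have ht : r + t + 1 - (r + 1) = t := by omega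
  rw [coe_take_sortedExps hr, arrEFlag, ht]
  set c : Fin (r + t) → ℤ := fun i => -(((n : ℤ) + (i : ℕ)) * a)
  let N' : {i : Fin (r + t) // ¬ (i : ℕ) < t} → Finset ℤ := fun j =>
    Finset.Icc (-(((n : ℤ) + t) * a)) (if (j.1 : ℕ) < p then (m : ℤ) else m + 1)
  rw [weightArr_restriction_fixSpace (N' := N')]
  · refine IndFree.comapEquiv ?_ _
    rcases r with _ | L
    · have : IsEmpty {i : Fin (0 + t) // ¬ (i : ℕ) < t} :=
        ⟨fun i => i.2 (by have := i.1.isLt; omega)⟩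
      simpa using indFree_weightArr_of_isEmpty a N'
    -- The number of integers in [-(n+t)a, m] is (n+t)a + m + 1; it is at least a because n ≥ 1.
    · have h := indFree_weightArr (a := a) (L := L) {i : Fin (L + 1 + t) // ¬ (i : ℕ) < t}
        (by rw [card_tail]; omega) (-(((n : ℤ) + t) * a)) ((n + t) * a + m + 1)
        (by nlinarith [Nat.zero_le (t * a), Nat.mul_le_mul_right a hn])
        (Finset.univ.filter fun j => ¬ (j.1 : ℕ) < p) (N := N') (by
          intro j
          simp only [N', Finset.mem_filter, Finset.mem_univ, true_and]
          push_cast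
          split_ifs <;> congr 1 <;> ring)
      convert h using 2
      obtain ⟨n, rfl⟩ := Nat.exists_eq_add_of_le' hn
      rw [map_range_bump, card_filter_tail]
      have h1 : min (L + 1 + t - p) (L + 1) = L + 1 + t - max p t := by omega
      have h2 : L + 1 + t + (n + 1) - 1 = L + 1 + t + n := by omega
      rw [h1, h2]
      congr 1
      · ring
      · exact map_range_congr fun i _ => by ring
  · intro j k
    have hj := j.2
    simp only [N', Finset.mem_Icc, mem_weightE, c]
    have hup : (k ≤ (if (j.1 : ℕ) < p then (m : ℤ) else m + 1)) ↔
        (k ≤ m ∨ ¬ (j.1 : ℕ) < p ∧ k ≤ m + 1) := by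
      split_ifs with h
      · simp [h]
      · simp only [h, not_false_eq_true, true_and]; omega
    rw [hup]
    clear hup
    constructor
    · rintro ⟨h1, h2⟩
      by_cases hk : -((n : ℤ) * a) ≤ k
      · exact Or.inl ⟨hk, h2⟩
      · right
        -- Locates k below -na in a half-open block of length a, which lies in the interval around
        -- the value of the coordinate i.
        have key : ∀ u : ℕ, -(((n : ℤ) + u) * a) ≤ k →
            ∃ i : ℕ, i < u ∧ -(((n : ℤ) + i + 1) * a) ≤ k ∧ k < -(((n : ℤ) + i) * a) := by
          intro u
          induction u with
          | zero => intro h; exact absurd (by simpa using h) hk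
          | succ u ih =>
            intro h
            by_cases hu : -(((n : ℤ) + u) * a) ≤ k
            · obtain ⟨i, h3, h4⟩ := ih hu
              exact ⟨i, by omega, h4⟩
            · refine ⟨u, by omega, ?_, by omega⟩
              push_cast at h
              rwa [← add_assoc] at h
        obtain ⟨i, hi, h3, h4⟩ := key t h1
        refine ⟨⟨i, by omega⟩, hi, ?_, ?_⟩
        · simp only
          linarith
        · simp only
          have : (0 : ℤ) ≤ a := by positivity
          linarith
    · rintro (⟨h1, h2⟩ | ⟨i, hi, h1, h2⟩)
      · refine ⟨?_, h2⟩
        have : (0 : ℤ) ≤ (t : ℤ) * a := by positivity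
        linarith
      · have hi' : ((i : ℕ) : ℤ) + 1 ≤ t := by exact_mod_cast hi
        have ha : (0 : ℤ) ≤ a := by positivity
        have hn' : (1 : ℤ) ≤ n := by exact_mod_cast hn
        refine ⟨by nlinarith, Or.inl ?_⟩
        have : (0 : ℤ) ≤ m := by positivity
        -- Since n ≥ 1, the upper end -(n+i-1)a of an adjoined interval is at most 0, hence at most
        -- m.
        have : (0 : ℤ) ≤ ((n : ℤ) - 1 + (i : ℕ)) * a := by
          refine mul_nonneg (by omega) ha
        linarith

theorem isIndFreeFlag_arrE {p ℓ n a m : ℕ} (hn : 1 ≤ n) (hℓ : 1 ≤ ℓ) (hp : p ≤ ℓ) :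
    IsIndFreeFlag (arrE p ℓ n a m).cone (arrEFlag ℓ n a)
      (sortedExps p ℓ (m + a * (ℓ + n - 1))) := by
  rw [cone_arrE]
  have hdim : Module.finrank ℝ ((Fin ℓ → ℝ) × ℝ) = ℓ + 1 := by simp [Module.finrank_prod]
  have hres : ∀ d, 1 ≤ d → d ≤ Module.finrank ℝ ((Fin ℓ → ℝ) × ℝ) →
      IndFree ((weightArr (Fin ℓ) a (weightE p ℓ n a m)).restriction (arrEFlag ℓ n a d))
        ((sortedExps p ℓ (m + a * (ℓ + n - 1))).take d : Multiset ℕ) := by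
    intro d h1 h2
    obtain ⟨r, rfl⟩ := Nat.exists_eq_add_of_le' h1
    exact indFree_restriction_arrEFlag hn (by omega) hp
  refine ⟨sortedExps_pairwise _ _ _, ?_, fun d h1 h2 => ?_, fun d h1 h2 => ?_,
    fun d h1 h2 => finrank_arrEFlag ℓ n a d h1 (hdim ▸ h2), hres⟩
  · obtain ⟨L, rfl⟩ := Nat.exists_eq_add_of_le' hℓ
    have h := indFree_weightArr (a := a) (L := L) (Fin (L + 1)) (by simp) (-((n : ℤ) * a))
        (n * a + m + 1) (by nlinarith [Nat.mul_le_mul_right a hn])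
        (Finset.univ.filter fun j => ¬ (j : ℕ) < p) (N := weightE p (L + 1) n a m) (by
          intro j
          simp only [weightE, Finset.mem_filter, Finset.mem_univ, true_and]
          push_cast
          split_ifs <;> congr 1 <;> ring)
    rw [← List.take_of_length_le (l := sortedExps _ _ _) (i := L + 1 + 1)
      (by simp [sortedExps]), coe_take_sortedExps le_rfl, map_range_bump]
    obtain ⟨n, rfl⟩ := Nat.exists_eq_add_of_le' hn
    have h1 : min (L + 1 - p) (L + 1) = L + 1 - p := by omega
    have h2 : L + 1 + (n + 1) - 1 = L + 1 + n := by omega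
    convert h using 2
    rw [card_filter_not_lt, h1, h2]
    congr 1
    · ring
    · exact map_range_congr fun i _ => by ring
  · intro w hw
    rw [arrEFlag, mem_fixSpace] at hw ⊢
    exact fun i hi => hw i (by omega)
  · refine ⟨arrEFlagPlane ℓ n a '' {i | (i : ℕ) < ℓ + 1 - d}, ?_, ?_⟩
    · rintro _ ⟨i, -, rfl⟩
      exact arrEFlagPlane_mem i
    · rw [arrEFlag_eq_iInf, sInf_image]
      rfl

theorem isIndFlagAccurate_arrE {p ℓ n a m : ℕ} (hn : 1 ≤ n) (hℓ : 1 ≤ ℓ) (hp : p ≤ ℓ) :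
    (arrE p ℓ n a m).cone.IsIndFlagAccurate :=
  ⟨_, (isIndFreeFlag_arrE hn hℓ hp).isIndFlagAccuracyWitness⟩

theorem hasExponents_arrE {p ℓ n a m : ℕ} (hn : 1 ≤ n) (hℓ : 1 ≤ ℓ) (hp : p ≤ ℓ) :
    (arrE p ℓ n a m).cone.HasExponents (shiftedExps p ℓ (m + a * (ℓ + n - 1))) := by
  have h := (isIndFreeFlag_arrE (a := a) (m := m) hn hℓ hp).indFree.hasExponents
  obtain ⟨L, rfl⟩ := Nat.exists_eq_add_of_le' hℓ
  rwa [coe_sortedExps] at h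

/-! ### Digraphic and extended Catalan arrangements. -/

theorem setOf_coord_sub_comm {ℓ : ℕ} (i j : Fin ℓ) (k : ℤ) :
    {x | (coord ℓ i - coord ℓ j) x = (k : ℝ)} =
      {x | (coord ℓ j - coord ℓ i) x = ((-k : ℤ) : ℝ)} := by
  ext x
  simp only [Set.mem_ofPred_eq, LinearMap.sub_apply]
  push_cast
  constructor <;> intro h <;> linarith

/-- Constants 0 and 1 for all ordered pairs amount to -1, 0, 1 for the pairs i < j, after exchanging
i and j. -/
theorem catalanOrigin_eq_arrE (p ℓ c m : ℕ) : catalanOrigin p ℓ c m = arrE p ℓ c 1 m := by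
  have hN : ∀ (i : Fin ℓ), (if (i : ℕ) < p then Finset.Icc (-(c : ℤ)) (m : ℤ)
      else Finset.Icc (-(c : ℤ)) ((m : ℤ) + 1)) =
      if (i : ℕ) < p then Finset.Icc (-((c : ℤ) * ((1 : ℕ) : ℤ))) (m : ℤ)
      else Finset.Icc (-((c : ℤ) * ((1 : ℕ) : ℤ))) ((m : ℤ) + 1) := by
    intro i
    simp
  ext H
  constructor
  · rintro (⟨i, j, hij, k, hk, rfl⟩ | ⟨i, k, hk, rfl⟩)
    · have hk' : k = 0 ∨ k = 1 := by
        dsimp only at hk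
        rw [if_pos hij] at hk
        simpa using hk
      rcases lt_or_gt_of_ne hij with h | h
      · refine Or.inl ⟨i, j, hij, k, ?_, rfl⟩
        dsimp only
        rw [if_pos h, Finset.mem_Icc]
        omega
      · refine Or.inl ⟨j, i, hij.symm, -k, ?_, setOf_coord_sub_comm i j k⟩
        dsimp only
        rw [if_pos h, Finset.mem_Icc]
        omega
    · exact Or.inr ⟨i, k, by dsimp only at hk ⊢; rwa [← hN], rfl⟩
  · rintro (⟨i, j, hij, k, hk, rfl⟩ | ⟨i, k, hk, rfl⟩)
    · dsimp only at hk
      split_ifs at hk with h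
      · rw [Finset.mem_Icc] at hk
        by_cases h0 : 0 ≤ k
        · refine Or.inl ⟨i, j, hij, k, ?_, rfl⟩
          dsimp only
          rw [if_pos hij, Finset.mem_insert, Finset.mem_singleton]
          omega
        · refine Or.inl ⟨j, i, hij.symm, -k, ?_, setOf_coord_sub_comm i j k⟩
          dsimp only
          rw [if_pos hij.symm, Finset.mem_insert, Finset.mem_singleton]
          omega
      · simp at hk
    · exact Or.inr ⟨i, k, by dsimp only at hk ⊢; rwa [hN], rfl⟩

theorem arrE_full_eq (ℓ : ℕ) {m : ℕ} (hm : 1 ≤ m) : arrE ℓ ℓ 1 m m = arrE 0 ℓ 1 m (m - 1) := by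
  obtain ⟨m, rfl⟩ := Nat.exists_eq_add_of_le' hm
  rw [arrE, arrE]
  congr 1
  funext i
  simp

/-- The coordinates `x_i = y_(i+1) - y_1` on the space `spaceA ℓ`. -/
def spaceAEquiv (ℓ : ℕ) : spaceA ℓ ≃ₗ[ℝ] (Fin ℓ → ℝ) where
  toFun y := fun i => y.1 i.succ - y.1 0
  map_add' v w := by ext; simp; ring
  map_smul' r w := by ext; simp; ring
  invFun x := ⟨Fin.cons (-((∑ i, x i) / (ℓ + 1))) fun i => x i - (∑ i, x i) / (ℓ + 1), by
    have : (ℓ : ℝ) + 1 ≠ 0 := by positivity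
    simp [spaceA, coord, Fin.sum_univ_succ, Finset.sum_sub_distrib]
    field_simp
    ring⟩
  left_inv y := by
    have hy : y.1 0 + ∑ i : Fin ℓ, y.1 i.succ = 0 := by
      have := y.2
      simpa [spaceA, coord, Fin.sum_univ_succ] using this
    have hs : (∑ i : Fin ℓ, y.1 i.succ - ℓ * y.1 0) / ((ℓ : ℝ) + 1) = -y.1 0 := by
      have : (ℓ : ℝ) + 1 ≠ 0 := by positivity
      rw [div_eq_iff this]
      linarith
    refine Subtype.ext (funext fun i => ?_)
    refine Fin.cases ?_ (fun i => ?_) i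
    · simp [hs]
    · simp [hs]
  right_inv x := by
    ext i
    simp

theorem spaceAEquiv_apply (ℓ : ℕ) (y : spaceA ℓ) (i : Fin ℓ) :
    spaceAEquiv ℓ y i = y.1 i.succ - y.1 0 := rfl

theorem rootA_apply (ℓ : ℕ) (i j : Fin (ℓ + 1)) (y : spaceA ℓ) :
    rootA ℓ i j y = y.1 i - y.1 j := rfl

theorem image_setOf_eq {V W : Type u} [AddCommGroup V] [Module ℝ V] [AddCommGroup W] [Module ℝ W]
    (φ : V ≃ₗ[ℝ] W) {α : Module.Dual ℝ V} {β : Module.Dual ℝ W} {c d : ℝ}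
    (h : ∀ v, α v = c ↔ β (φ v) = d) : φ '' {v | α v = c} = {w | β w = d} := by
  have : {v | α v = c} = φ ⁻¹' {w | β w = d} := Set.ext h
  rw [this, Set.image_preimage_eq _ φ.surjective]

/-- With x_i = y_(i+1) - y_1, the roots not involving y_1 become differences of coordinates and the
others become -x_j; the interval [-m, m] is symmetric under the sign. -/
theorem image_planes_extCatalanA (ℓ : ℕ) {m : ℕ} (hm : 1 ≤ m) :
    (arrE 0 ℓ 1 m (m - 1)).planes =
      (fun H : Set (spaceA ℓ) => spaceAEquiv ℓ '' H) '' (extCatalanA ℓ m).planes := by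
  obtain ⟨m, rfl⟩ := Nat.exists_eq_add_of_le' hm
  have hroot : ∀ (i j : Fin ℓ) (k : ℤ), spaceAEquiv ℓ '' {v | rootA ℓ i.succ j.succ v = (k : ℝ)} =
      {x | (coord ℓ i - coord ℓ j) x = (k : ℝ)} := fun i j k => image_setOf_eq _ fun v => by
    rw [rootA_apply]
    simp [coord, spaceAEquiv_apply]
  have hroot0 : ∀ (j : Fin ℓ) (k : ℤ), spaceAEquiv ℓ '' {v | rootA ℓ 0 j.succ v = (k : ℝ)} =
      {x | coord ℓ j x = ((-k : ℤ) : ℝ)} := fun j k => image_setOf_eq _ fun v => by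
    rw [rootA_apply]
    simp only [coord, LinearMap.proj_apply, spaceAEquiv_apply]
    push_cast
    constructor <;> intro h <;> linarith
  ext H
  constructor
  · rintro (⟨i, j, hij, k, hk, rfl⟩ | ⟨i, k, hk, rfl⟩)
    · dsimp only at hk
      split_ifs at hk with h
      · exact ⟨_, ⟨i.succ, j.succ, Fin.succ_lt_succ_iff.2 h, k, hk, rfl⟩, hroot i j k⟩
      · simp at hk
    · dsimp only at hk
      rw [if_neg (Nat.not_lt_zero _), Finset.mem_Icc] at hk
      refine ⟨_, ⟨0, i.succ, Fin.succ_pos i, -k, ?_, rfl⟩, ?_⟩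
      · rw [Finset.mem_Icc]
        push_cast at hk ⊢
        omega
      · rw [← neg_neg k]
        simpa using hroot0 i (-k)
  · rintro ⟨_, ⟨i, j, hij, k, hk, rfl⟩, rfl⟩
    obtain ⟨j, rfl⟩ := Fin.exists_succ_eq.2 (Fin.ne_zero_of_lt hij)
    dsimp only
    rcases Fin.eq_zero_or_eq_succ i with rfl | ⟨i, rfl⟩
    · rw [hroot0]
      refine Or.inr ⟨j, -k, ?_, rfl⟩
      dsimp only
      rw [if_neg (Nat.not_lt_zero _), Finset.mem_Icc]
      rw [Finset.mem_Icc] at hk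
      push_cast at hk ⊢
      omega
    · rw [hroot]
      rw [Fin.succ_lt_succ_iff] at hij
      exact Or.inl ⟨i, j, hij.ne, k, by dsimp only; rwa [if_pos hij], rfl⟩

theorem cone_eq_comap {V W : Type u} [AddCommGroup V] [Module ℝ V] [AddCommGroup W] [Module ℝ W]
    {A : AffineArr V} {B : AffineArr W} (φ : V ≃ₗ[ℝ] W)
    (h : B.planes = (fun H : Set V => φ '' H) '' A.planes) :
    A.cone = B.cone.comap (φ.prodCongr (LinearEquiv.refl ℝ ℝ)).toLinearMap
      (φ.prodCongr (LinearEquiv.refl ℝ ℝ)).surjective := by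
  ext K
  constructor
  · rintro (rfl | ⟨α, c, hα, hH, rfl⟩)
    · exact ⟨_, Or.inl rfl, rfl⟩
    · refine ⟨homogenize (α.comp φ.symm.toLinearMap) c, Or.inr ⟨_, c, fun h0 => hα ?_, ?_, rfl⟩, ?_⟩
      · ext v
        simpa using LinearMap.congr_fun h0 (φ v)
      · rw [h]
        exact ⟨_, hH, image_setOf_eq φ fun v => by simp⟩
      · ext w
        simp [mem_homogenize]
  · rintro ⟨_, rfl | ⟨β, c, hβ, hH, rfl⟩, rfl⟩
    · exact Or.inl rfl
    · rw [h] at hH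
      obtain ⟨H, hH, hHβ⟩ := hH
      refine Or.inr ⟨β.comp φ.toLinearMap, c, fun h0 => hβ ?_, ?_, ?_⟩
      · ext w
        simpa using LinearMap.congr_fun h0 (φ.symm w)
      · have : {v | (β.comp φ.toLinearMap) v = c} = H := by
          rw [← Set.preimage_image_eq H φ.injective]
          dsimp only at hHβ
          rw [hHβ]
          rfl
        rwa [this]
      · ext w
        simp [mem_homogenize]

theorem flagPlaneE_eq (ℓ m : ℕ) (i : Fin ℓ) : flagPlaneE ℓ m i = arrEFlagPlane ℓ 1 m i := by
  rw [flagPlaneE, arrEFlagPlane]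
  split_ifs
  · ext w
    simp [mem_homogenize, mem_coordPlane, coord]
  · ext w
    simp [mem_homogenize, mem_diffPlane, coord]

theorem flagE_eq (ℓ m : ℕ) : flagE ℓ m = arrEFlag ℓ 1 m := by
  funext d
  simp only [flagE, arrEFlag_eq_iInf, flagPlaneE_eq]

theorem catalanFlag_eq (ℓ m : ℕ) : catalanFlag ℓ m = fun d => (flagE ℓ m d).comap
    ((spaceAEquiv ℓ).prodCongr (LinearEquiv.refl ℝ ℝ)).toLinearMap := by
  funext d
  rw [catalanFlag, flagE, Submodule.comap_iInf]
  refine iInf_congr fun i => ?_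
  rw [Submodule.comap_iInf]
  refine iInf_congr fun _ => ?_
  ext ⟨y, z⟩
  rw [flagPlaneE]
  split_ifs with h0
  · have h1 : i.castSucc = 0 := Fin.ext h0
    simp only [mem_homogenize, simpleRootA, rootA_apply, h1, Submodule.mem_comap,
      LinearEquiv.coe_coe, LinearEquiv.prodCongr_apply, LinearEquiv.refl_apply, coord,
      LinearMap.proj_apply, spaceAEquiv_apply]
    constructor <;> intro h <;> linarith
  · have h1 : (⟨(i : ℕ) - 1, lt_of_le_of_lt (Nat.sub_le _ _) i.isLt⟩ : Fin ℓ).succ = i.castSucc :=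
      Fin.ext (by simp only [Fin.val_succ, Fin.val_castSucc]; omega)
    simp only [mem_homogenize, simpleRootA, rootA_apply, Submodule.mem_comap,
      LinearEquiv.coe_coe, LinearEquiv.prodCongr_apply, LinearEquiv.refl_apply, coord,
      LinearMap.proj_apply, LinearMap.sub_apply, spaceAEquiv_apply, h1]
    constructor <;> intro h <;> linarith

theorem isSimpleRootFlag_catalanFlag {ℓ : ℕ} (hℓ : 1 ≤ ℓ) (m : ℕ) :
    IsSimpleRootFlag ℓ (catalanFlag ℓ m) := by
  -- The simple roots are counted from 1 here and from 0 in the flag. The minimum only keeps the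
  -- index in range and is inactive for 1 ≤ i ≤ s.
  refine ⟨fun i => ⟨min (i - 1) (ℓ - 1), by omega⟩, fun _ => m, fun s h1 h2 => ?_⟩
  have hs : ℓ + 1 - (ℓ + 1 - s) = s := by omega
  rw [catalanFlag, hs]
  ext w
  simp only [Submodule.mem_iInf, Finset.mem_Icc, Int.cast_natCast]
  constructor
  · rintro h i ⟨hi1, hi2⟩
    exact h _ (by simp only; omega)
  · intro h i hi
    have := h (i + 1) ⟨by omega, by omega⟩
    have hi' : (⟨min ((i : ℕ) + 1 - 1) (ℓ - 1), by omega⟩ : Fin ℓ) = i := Fin.ext (by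
      have := i.isLt
      simp only
      omega)
    rwa [hi'] at this

theorem isIndFreeFlag_extCatalanA {ℓ m : ℕ} (hℓ : 1 ≤ ℓ) (hm : 1 ≤ m) :
    IsIndFreeFlag (extCatalanA ℓ m).cone (catalanFlag ℓ m)
      (sortedExps 0 ℓ (m - 1 + m * (ℓ + 1 - 1))) := by
  rw [cone_eq_comap (spaceAEquiv ℓ) (image_planes_extCatalanA ℓ hm), catalanFlag_eq, flagE_eq]
  exact (isIndFreeFlag_arrE le_rfl hℓ (Nat.zero_le ℓ)).comapEquiv _

theorem coe_sortedExps_zero (ℓ : ℕ) {m : ℕ} (hm : 1 ≤ m) :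
    (sortedExps 0 ℓ (m - 1 + m * (ℓ + 1 - 1)) : Multiset ℕ) =
      1 ::ₘ (Finset.Icc 1 ℓ).val.map fun i => m * (ℓ + 1) + i := by
  obtain ⟨m, rfl⟩ := Nat.exists_eq_add_of_le' hm
  have h1 : (Finset.Icc 1 ℓ).val = (Multiset.range ℓ).map fun i => i + 1 := by
    change ((List.range' 1 ℓ : List ℕ) : Multiset ℕ) = _
    rw [List.range'_eq_map_range]
    simp [← Multiset.coe_range, add_comm]
  have h2 := coe_take_sortedExps (p := 0) (s := m + 1 - 1 + (m + 1) * (ℓ + 1 - 1)) (le_refl ℓ)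
  rw [List.take_of_length_le (by simp [sortedExps])] at h2
  rw [h1, h2, Multiset.map_map]
  congr 1
  refine map_range_congr fun i hi => ?_
  rw [if_pos (by omega), Nat.add_sub_cancel, Nat.add_sub_cancel, Function.comp_apply]
  ring

end

end HypArr


theorem mainTheorem8 :
    (∀ a m n ℓ p : ℕ, 1 ≤ n → 1 ≤ ℓ → p ≤ ℓ →
      (HypArr.arrE p ℓ n a m).cone.IsIndFlagAccurate ∧
      (HypArr.arrE p ℓ n a m).cone.HasExponents
        (HypArr.shiftedExps p ℓ (m + a * (ℓ + n - 1)))) ∧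
    (∀ c m ℓ p : ℕ, 1 ≤ c → 1 ≤ ℓ → p ≤ ℓ →
      HypArr.catalanOrigin p ℓ c m = HypArr.arrE p ℓ c 1 m ∧
      (HypArr.catalanOrigin p ℓ c m).cone.IsIndFlagAccurate ∧
      (HypArr.catalanOrigin p ℓ c m).cone.HasExponents
        (HypArr.shiftedExps p ℓ (m + ℓ + c - 1))) ∧
    (∀ ℓ m : ℕ, 1 ≤ ℓ → 1 ≤ m →
      (HypArr.extCatalanA ℓ m).AffinelyEquivalent (HypArr.arrE ℓ ℓ 1 m m) ∧
      (HypArr.extCatalanA ℓ m).AffinelyEquivalent (HypArr.arrE 0 ℓ 1 m (m - 1)) ∧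
      (HypArr.extCatalanA ℓ m).cone.IsIndFlagAccurate ∧
      (HypArr.extCatalanA ℓ m).cone.HasExponents
        (1 ::ₘ (Finset.Icc 1 ℓ).val.map fun i => m * (ℓ + 1) + i) ∧
      (HypArr.extCatalanA ℓ m).cone.IsIndFlagAccuracyWitness (HypArr.catalanFlag ℓ m) ∧
      HypArr.IsSimpleRootFlag ℓ (HypArr.catalanFlag ℓ m) ∧
      (HypArr.arrE 0 ℓ 1 m (m - 1)).cone.IsIndFlagAccuracyWitness (HypArr.flagE ℓ m)) := by
  refine ⟨fun a m n ℓ p hn hℓ hp => ⟨HypArr.isIndFlagAccurate_arrE hn hℓ hp,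
    HypArr.hasExponents_arrE hn hℓ hp⟩, fun c m ℓ p hc hℓ hp => ?_, fun ℓ m hℓ hm => ?_⟩
  · rw [HypArr.catalanOrigin_eq_arrE]
    refine ⟨rfl, HypArr.isIndFlagAccurate_arrE hc hℓ hp, ?_⟩
    have h := HypArr.hasExponents_arrE (a := 1) (m := m) hc hℓ hp
    have hs : m + 1 * (ℓ + c - 1) = m + ℓ + c - 1 := by omega
    rwa [hs] at h
  · have haff : (HypArr.extCatalanA ℓ m).AffinelyEquivalent (HypArr.arrE 0 ℓ 1 m (m - 1)) :=
      ⟨(HypArr.spaceAEquiv ℓ).toAffineEquiv, HypArr.image_planes_extCatalanA ℓ hm⟩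
    have hflag := HypArr.isIndFreeFlag_extCatalanA hℓ hm
    refine ⟨by rwa [HypArr.arrE_full_eq ℓ hm], haff, ⟨_, hflag.isIndFlagAccuracyWitness⟩, ?_,
      hflag.isIndFlagAccuracyWitness, HypArr.isSimpleRootFlag_catalanFlag hℓ m, ?_⟩
    · rw [← HypArr.coe_sortedExps_zero ℓ hm]
      exact hflag.indFree.hasExponents
    · rw [HypArr.flagE_eq]
      exact (HypArr.isIndFreeFlag_arrE le_rfl hℓ (Nat.zero_le ℓ)).isIndFlagAccuracyWitness
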